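/- Let $n \ge 3$ and let $T^{2n} = \mathbb{R}^{2n}/\mathbb{Z}^{2n}$ be the standard symplectic torus, with the symplectic form $\omega = \sum_{i=1}^{n} dx_{2i-1} \wedge dx_{2i}$. Let $k \ge 1$ be an integer and let $W \subset T^{2n}$ be a symplectic hyperplane section of degree $k$, that is, a closed (compact, without boundary) embedded smooth submanifold of codimension $2$ such that $\omega$ restricts to a symplectic form on $W$ and such that the homology class of $W$, oriented by $\omega^{n-1}|_W$, is Poincaré dual to $k[\omega]$: $$\int_W \alpha = k \int_{T^{2n}} \alpha \wedge \omega \quad \text{for every closed smooth } (2n-2)\text{-form } \alpha \text{ on } T^{2n}.$$ Then $W$ is connected (and non-empty). -/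

import Mathlib

open scoped ContDiff

noncomputable section

namespace SymplecticTorus

/-! ### Exterior algebra -/

/-- The exterior product of a `p`-form and a `q`-form on a real vector space, with the shuffle
normalization `(a ∧ b)(v, w) = a v * b w - a w * b v` for `1`-forms. -/
def wedge {E : Type*} [AddCommGroup E] [Module ℝ E] {p q r : ℕ} (h : p + q = r)
    (a : E [⋀^Fin p]→ₗ[ℝ] ℝ) (b : E [⋀^Fin q]→ₗ[ℝ] ℝ) : E [⋀^Fin r]→ₗ[ℝ] ℝ :=
  ((LinearMap.mul' ℝ ℝ).compAlternatingMap (a.domCoprod b)).domDomCongr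
    (finSumFinEquiv.trans (finCongr h))

/-- The `j`-th exterior power `a ∧ ⋯ ∧ a` of a `2`-form, a form of degree `2 * j`. -/
def wedgePow {E : Type*} [AddCommGroup E] [Module ℝ E] (a : E [⋀^Fin 2]→ₗ[ℝ] ℝ) :
    (j : ℕ) → E [⋀^Fin (2 * j)]→ₗ[ℝ] ℝ
  | 0 => AlternatingMap.constOfIsEmpty ℝ E (Fin 0) 1
  | j + 1 => wedge (show 2 * j + 2 = 2 * (j + 1) by omega) (wedgePow a j) a

/-- A linear form, seen as an alternating form of degree `1`. -/
def oneForm {E : Type*} [AddCommGroup E] [Module ℝ E] (l : E →ₗ[ℝ] ℝ) : E [⋀^Fin 1]→ₗ[ℝ] ℝ :=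
  AlternatingMap.ofSubsingleton ℝ E ℝ (0 : Fin 1) l

/-- The coordinate form `dx_i` on `ℝ^N`. -/
def dx {N : ℕ} (i : Fin N) : (Fin N → ℝ) [⋀^Fin 1]→ₗ[ℝ] ℝ :=
  oneForm (LinearMap.proj i)

/-- The standard symplectic form `dx_0 ∧ dx_1 + dx_2 ∧ dx_3 + ⋯ + dx_(2n-2) ∧ dx_(2n-1)`. As it has
constant coefficients, it is at the same time a `2`-form on `ℝ^(2n)` and on the torus. -/
def stdSymplectic (n : ℕ) : (Fin (2 * n) → ℝ) [⋀^Fin 2]→ₗ[ℝ] ℝ :=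
  ∑ i : Fin n, wedge (show 1 + 1 = 2 from rfl)
    (dx ⟨2 * (i : ℕ), by omega⟩) (dx ⟨2 * (i : ℕ) + 1, by omega⟩)

/-! ### The torus `ℝ^N / ℤ^N` and differential forms on it -/

/-- The covering map `ℝ^N → ℝ^N / ℤ^N`. -/
def cover (N : ℕ) (x : Fin N → ℝ) : UnitAddTorus (Fin N) := fun i => (x i : UnitAddCircle)

/-- Differential `p`-forms on the torus `ℝ^N / ℤ^N`. The differential of the covering map identifies
every tangent space of the torus with `ℝ^N`, so a (not necessarily continuous) form is a function
from the torus to the alternating forms on `ℝ^N`. -/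
abbrev TorusForm (N p : ℕ) : Type := UnitAddTorus (Fin N) → (Fin N → ℝ) [⋀^Fin p]→L[ℝ] ℝ

/-- The form is smooth: its pullback to `ℝ^N` is. -/
def TorusForm.IsSmooth {N p : ℕ} (α : TorusForm N p) : Prop :=
  ContDiff ℝ ∞ (fun x => α (cover N x))

/-- The form is closed: the exterior derivative of its pullback to `ℝ^N` vanishes. -/
def TorusForm.IsClosed {N p : ℕ} (α : TorusForm N p) : Prop :=
  ∀ x, extDeriv (fun x => α (cover N x)) x = 0

/-- The integral of a form of top degree over the torus, oriented by the standard basis of `ℝ^N`,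
that is, by `dx_0 ∧ ⋯ ∧ dx_(N-1)`. -/
def torusIntegral {N : ℕ} (β : UnitAddTorus (Fin N) → (Fin N → ℝ) [⋀^Fin N]→ₗ[ℝ] ℝ) : ℝ :=
  ∫ x, β x (fun i => Pi.single i 1)

/-! ### Submanifolds of the torus -/

/-- The map `cover N ∘ φ`, on the open set `U` of `ℝ^m`, is a smooth local parametrization of the
subset `W` of the torus: an immersion and a homeomorphism from `U` onto a relatively open subset of
`W`. (Locally every smooth map to the torus lifts to `ℝ^N`, so asking for a lift `φ` is no
restriction for the purposes of local parametrizations.) -/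
structure IsLocalParam {N m : ℕ} (W : Set (UnitAddTorus (Fin N))) (U : Set (Fin m → ℝ))
    (φ : (Fin m → ℝ) → (Fin N → ℝ)) : Prop where
  isOpen : IsOpen U
  smooth : ContDiffOn ℝ ∞ φ U
  immersion : ∀ u ∈ U, Function.Injective (fderiv ℝ φ u)
  injOn : Set.InjOn (fun u => cover N (φ u)) U
  isOpenMap : ∀ U' ⊆ U, IsOpen U' →
    ∃ O : Set (UnitAddTorus (Fin N)), IsOpen O ∧ (fun u => cover N (φ u)) '' U' = W ∩ O

/-- `W` is a closed (compact, without boundary) embedded smooth `m`-dimensional submanifold of the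
torus. -/
structure IsClosedSubmanifold {N : ℕ} (m : ℕ) (W : Set (UnitAddTorus (Fin N))) : Prop where
  isCompact : IsCompact W
  exists_param : ∀ p ∈ W, ∃ (U : Set (Fin m → ℝ)) (φ : (Fin m → ℝ) → (Fin N → ℝ)),
    IsLocalParam W U φ ∧ ∃ u ∈ U, cover N (φ u) = p

/-- The restriction of the `2`-form `σ` to each tangent space of the `m`-dimensional submanifold `W`
is non-degenerate. The tangent spaces of `W` are the images of the differentials of the local
parametrizations. -/
def IsSymplecticOn {N : ℕ} (m : ℕ) (σ : (Fin N → ℝ) [⋀^Fin 2]→ₗ[ℝ] ℝ)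
    (W : Set (UnitAddTorus (Fin N))) : Prop :=
  ∀ (U : Set (Fin m → ℝ)) (φ : (Fin m → ℝ) → (Fin N → ℝ)), IsLocalParam W U φ → ∀ u ∈ U,
    ∀ v : Fin m → ℝ, (∀ w : Fin m → ℝ, σ ![fderiv ℝ φ u v, fderiv ℝ φ u w] = 0) → v = 0

/-! ### Integration over oriented submanifolds -/

/-- The pullback of an alternating form `a` by the differential of `φ` at `u`, evaluated on the
standard basis: `a (∂_0 φ, …, ∂_(m-1) φ)`. -/
def pullbackCoeff {N m : ℕ} (φ : (Fin m → ℝ) → (Fin N → ℝ)) (u : Fin m → ℝ)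
    (a : (Fin N → ℝ) [⋀^Fin m]→ₗ[ℝ] ℝ) : ℝ :=
  a (fun i => fderiv ℝ φ u (Pi.single i 1))

/-- Data for integrating over the `m`-dimensional submanifold `W`, oriented by the `m`-form `θ`:
finitely many positively oriented local parametrizations and a smooth partition of unity along `W`
that is subordinate to their images. -/
structure OrientedPartition {N m : ℕ} (θ : (Fin N → ℝ) [⋀^Fin m]→ₗ[ℝ] ℝ)
    (W : Set (UnitAddTorus (Fin N))) where
  /-- The number of local parametrizations. -/
  r : ℕ
  /-- The domains of the local parametrizations. -/
  U : Fin r → Set (Fin m → ℝ)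
  /-- The local parametrizations. -/
  φ : Fin r → (Fin m → ℝ) → (Fin N → ℝ)
  /-- The functions of the partition of unity. -/
  ρ : Fin r → UnitAddTorus (Fin N) → ℝ
  isLocalParam : ∀ j, IsLocalParam W (U j) (φ j)
  oriented : ∀ j, ∀ u ∈ U j, 0 < pullbackCoeff (φ j) u θ
  smooth : ∀ j, ContDiff ℝ ∞ (fun x => ρ j (cover N x))
  nonneg : ∀ j p, 0 ≤ ρ j p
  sum_eq_one : ∀ p ∈ W, ∑ j, ρ j p = 1
  subordinate : ∀ j, tsupport (ρ j) ∩ W ⊆ (fun u => cover N (φ j u)) '' U j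

/-- The integral of the form `α` over `W`, computed with the given parametrizations and partition
of unity. -/
def OrientedPartition.integral {N m : ℕ} {θ : (Fin N → ℝ) [⋀^Fin m]→ₗ[ℝ] ℝ}
    {W : Set (UnitAddTorus (Fin N))} (P : OrientedPartition θ W) (α : TorusForm N m) : ℝ :=
  ∑ j, ∫ u in P.U j, P.ρ j (cover N (P.φ j u)) *
    pullbackCoeff (P.φ j) u (α (cover N (P.φ j u))).toAlternatingMap

open Classical in
/-- The integral `∫_W α` of an `m`-form over the closed `m`-dimensional submanifold `W` with the
orientation given by `θ`. As usual, it is computed with some choice of oriented parametrizations and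
of a partition of unity, on which the value does not depend for smooth `α`. (Such a choice exists
if `W` is a closed submanifold on whose tangent spaces `θ` does not vanish, the only case of
interest, except that in dimension `m = 0` the form `θ` has to be positive.) -/
def integralOver {N m : ℕ} (θ : (Fin N → ℝ) [⋀^Fin m]→ₗ[ℝ] ℝ)
    (W : Set (UnitAddTorus (Fin N))) (α : TorusForm N m) : ℝ :=
  if h : Nonempty (OrientedPartition θ W) then h.some.integral α else 0

/-! ### Symplectic hyperplane sections -/

/-- `W` is a symplectic hyperplane section of degree `k` in the standard symplectic torus of
dimension `2n`: a closed embedded submanifold of codimension `2` to whose tangent spaces the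
standard symplectic form `ω` restricts as a symplectic form, and whose homology class, for the
orientation given by `ω ^ (n - 1)`, is Poincaré dual to `k [ω]`, that is, `∫_W α = ∫ α ∧ k ω` for all
closed smooth forms `α` of degree `2n - 2`. -/
structure IsSymplecticHyperplaneSection (n : ℕ) (hn : 0 < n) (k : ℕ)
    (W : Set (UnitAddTorus (Fin (2 * n)))) : Prop where
  isClosedSubmanifold : IsClosedSubmanifold (2 * (n - 1)) W
  isSymplectic : IsSymplecticOn (2 * (n - 1)) (stdSymplectic n) W
  poincareDual : ∀ α : TorusForm (2 * n) (2 * (n - 1)), α.IsSmooth → α.IsClosed →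
    integralOver (wedgePow (stdSymplectic n) (n - 1)) W α =
      torusIntegral (fun x => wedge (show 2 * (n - 1) + 2 = 2 * n by omega)
        (α x).toAlternatingMap ((k : ℝ) • stdSymplectic n))

end SymplecticTorus

end

noncomputable section

namespace SymplecticTorus

open MeasureTheory

/-! Suppose that `W` splits into two disjoint non-empty closed pieces. The second cohomology of the
torus consists of constant `2`-forms, so the pieces have Poincaré duals `a` and `b` with constant
coefficients. Then `a + b` is `k ω`, hence non-degenerate, and `a ∧ b = 0` because the pieces do not
meet. In dimension at least `5` this forces `a = 0` or `b = 0`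
(`eq_zero_or_eq_zero_of_wedge_eq_zero`). But `ω ^ (n - 1)` has positive integral over each non-empty
piece (`OrientedPartition.functional_pos`), a contradiction.

The vanishing of `a ∧ b` is proved by Fourier analysis (`wedge_eq_zero_of_disjoint`). A piece
defines the functionals `S u v : f ↦ ∫ f ι_v ι_u vol`, whose values at `f = 1` describe its class.
Exact forms integrate to zero over `W` by Poincaré duality itself, so Stokes' theorem is not needed.
A cut-off function that is locally constant near `W` transfers this to each piece. On the character
of frequency `m` it says `m ∧ S = 0`, so for `m ≠ 0` the Fourier coefficient `S` is a multiple of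
`m`. The convolution of the two families, combined as in a wedge product, therefore has no nonzero
frequency and is a multiple of Haar measure. It is supported in the difference set of the pieces,
which misses `0`, so it vanishes. Its total mass is `a ∧ b`.

The classes appear as the bilinear forms `(u, v) ↦ ∫_W g ι_v ι_u vol`. They are compared with `k ω`
only up to nonzero factors on the entries, which is enough for non-degeneracy. -/

/-! ### Linear algebra of decomposable sums -/

/-- If two alternating forms `a`, `b` satisfy `a ∧ b = 0` and their sum is non-degenerate on a space
of dimension at least `5`, then one of them vanishes. -/
theorem eq_zero_or_eq_zero_of_wedge_eq_zero {V : Type*} [AddCommGroup V] [Module ℝ V]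
    [FiniteDimensional ℝ V] (a b : LinearMap.BilinForm ℝ V)
    (hnd : (a + b).Nondegenerate) (hdim : 5 ≤ Module.finrank ℝ V)
    (h : ∀ u v w x, a u v * b w x - a u w * b v x + a u x * b v w
      + b u v * a w x - b u w * a v x + b u x * a v w = 0) : a = 0 ∨ b = 0 := by
  -- The functionals `a u` and `b u` are proportional. Otherwise their common kernel `K` has
  -- codimension `2`, and the hypothesis at `(u, v, r, s)` and `(u, w, r, s)` with `r, s ∈ K` is an
  -- invertible linear system for `a r s` and `b r s`. So `K` is isotropic for `a + b`, whence `2 (d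
  -- - 2) ≤ d` for the dimension `d`, impossible for `d ≥ 5`.
  have key : ∀ u v w, a u v * b u w = a u w * b u v := by
    intro u v w
    by_contra hne
    have hd : a u v * b u w - a u w * b u v ≠ 0 := sub_ne_zero.2 hne
    set K : Submodule ℝ V := LinearMap.ker ((a u).prod (b u)) with hK
    have hKmem : ∀ r, r ∈ K ↔ a u r = 0 ∧ b u r = 0 := by
      intro r
      simp [hK, LinearMap.mem_ker]
    have hiso : ∀ r ∈ K, ∀ s ∈ K, (a + b) r s = 0 := by
      intro r hr s hs
      obtain ⟨hr1, hr2⟩ := (hKmem r).1 hr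
      obtain ⟨hs1, hs2⟩ := (hKmem s).1 hs
      have h1 := h u v r s
      have h2 := h u w r s
      rw [hr1, hr2, hs1, hs2] at h1 h2
      have e1 : (a u v * b u w - a u w * b u v) * a r s = 0 := by linear_combination a u v * h2 - a u w * h1
      have e2 : (a u v * b u w - a u w * b u v) * b r s = 0 := by linear_combination b u w * h1 - b u v * h2
      have e1' := (mul_eq_zero.1 e1).resolve_left hd
      have e2' := (mul_eq_zero.1 e2).resolve_left hd
      simp [e1', e2']
    have hle : K ≤ (a + b).orthogonal K := by
      intro s hs
      rw [LinearMap.BilinForm.mem_orthogonal_iff]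
      exact fun r hr => hiso r hr s hs
    have h1 := Submodule.finrank_mono hle
    rw [LinearMap.BilinForm.finrank_orthogonal hnd] at h1
    have h2 := LinearMap.finrank_range_add_finrank_ker ((a u).prod (b u))
    have h3 := Submodule.finrank_le (LinearMap.range ((a u).prod (b u)))
    have h4 : Module.finrank ℝ (ℝ × ℝ) = 2 := by simp
    change Module.finrank ℝ _ + Module.finrank ℝ K = _ at h2
    omega
  -- The operator `Ω⁻¹ a` preserves every line.
  let e := (a + b).toDual hnd
  let A : V →ₗ[ℝ] V := e.symm.toLinearMap ∘ₗ a
  have hA : ∀ u v, (a + b) (A u) v = a u v := by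
    intro u v
    exact LinearMap.BilinForm.apply_toDual_symm_apply (hB := hnd) (a u) v
  have hline : ∀ u, ∃ c : ℝ, A u = c • u := by
    intro u
    by_cases hu : u = 0
    · exact ⟨0, by simp [hu]⟩
    · obtain ⟨w, hw⟩ : ∃ w, (a + b) u w ≠ 0 := by
        by_contra! hcon
        exact hu (hnd.1 u hcon)
      refine ⟨a u w / (a + b) u w, ?_⟩
      rw [← sub_eq_zero]
      refine hnd.1 _ fun v => ?_
      rw [map_sub, LinearMap.sub_apply, hA, map_smul, LinearMap.smul_apply, smul_eq_mul, sub_eq_zero,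
        div_mul_eq_mul_div, eq_div_iff hw]
      simp only [LinearMap.add_apply]
      linear_combination key u v w
  obtain ⟨c, hc⟩ := LinearMap.exists_eq_smul_id_of_forall_notLinearIndependent (f := A) (by
    intro u hu
    obtain ⟨c, hc⟩ := hline u
    rw [hc, LinearIndependent.pair_iff] at hu
    have := hu c (-1) (by simp)
    norm_num at this)
  have hac : ∀ u v, a u v = c * (a + b) u v := by
    intro u v
    rw [← hA, hc]; simp [mul_add]
  have hbc : ∀ u v, b u v = (1 - c) * (a + b) u v := by
    intro u v
    have := hac u v
    rw [LinearMap.add_apply, LinearMap.add_apply] at this ⊢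
    linear_combination -this
  -- Now `a ∧ b` is `c (1 - c)` times the square of `a + b`. The vectors `u, v, w, x` are chosen to
  -- make that square nonzero: `w` is orthogonal to `u` and `v`, so only the terms with `(a + b) u v
  -- * (a + b) w x` survive.
  obtain ⟨u, hu⟩ : ∃ u : V, u ≠ 0 := by
    have : Nontrivial V := Module.nontrivial_of_finrank_pos (R := ℝ) (by omega)
    exact exists_ne 0
  obtain ⟨v, hv⟩ : ∃ v, (a + b) u v ≠ 0 := by
    by_contra! hcon
    exact hu (hnd.1 u hcon)
  obtain ⟨w, hw, hw0⟩ : ∃ w ∈ LinearMap.ker (((a + b) u).prod ((a + b) v)), w ≠ 0 := by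
    refine Submodule.exists_mem_ne_zero_of_ne_bot fun hbot => ?_
    have h2 := LinearMap.finrank_range_add_finrank_ker (((a + b) u).prod ((a + b) v))
    have h3 := Submodule.finrank_le (LinearMap.range (((a + b) u).prod ((a + b) v)))
    have h4 : Module.finrank ℝ (ℝ × ℝ) = 2 := by simp
    rw [hbot, finrank_bot] at h2
    omega
  obtain ⟨x, hx⟩ : ∃ x, (a + b) w x ≠ 0 := by
    by_contra! hcon
    exact hw0 (hnd.1 w hcon)
  obtain ⟨hw1, hw2⟩ : (a + b) u w = 0 ∧ (a + b) v w = 0 := by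
    simpa only [LinearMap.mem_ker, LinearMap.prod_apply, Function.prod_apply, Prod.mk_eq_zero] using hw
  have hQ := h u v w x
  simp only [hac, hbc, hw1, hw2] at hQ
  have hc0 : c * (1 - c) = 0 := by
    have : c * (1 - c) * (2 * ((a + b) u v * (a + b) w x)) = 0 := by linear_combination hQ
    exact (mul_eq_zero.1 this).resolve_right (mul_ne_zero two_ne_zero (mul_ne_zero hv hx))
  rcases mul_eq_zero.1 hc0 with hc' | hc'
  · exact Or.inl (LinearMap.ext₂ fun u v => by rw [hac, hc']; simp)
  · exact Or.inr (LinearMap.ext₂ fun u v => by rw [hbc, hc']; simp)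

/-! ### Contractions of the volume form -/

/-- The vectors of the standard basis of `ℝ^N`. -/
abbrev stdVec {N : ℕ} (i : Fin N) : Fin N → ℝ := Pi.single i 1

/-- The contraction `ι_v ι_u vol` of the standard volume form `vol(u, v, …)` of `ℝ^(M+2)`. -/
def contractVol {M : ℕ} (u v : Fin (M + 2) → ℝ) : (Fin (M + 2) → ℝ) [⋀^Fin M]→ₗ[ℝ] ℝ :=
  ((Matrix.detRowAlternating (n := Fin (M + 2)) (R := ℝ)).curryLeft u).curryLeft v

theorem contractVol_apply {M : ℕ} (u v : Fin (M + 2) → ℝ) (w : Fin M → Fin (M + 2) → ℝ) :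
    contractVol u v w =
      Matrix.detRowAlternating (Matrix.vecCons u (Matrix.vecCons v w)) := rfl

theorem contractVol_add_left {M : ℕ} (u u' v : Fin (M + 2) → ℝ) :
    contractVol (u + u') v = contractVol u v + contractVol u' v := by
  ext w; simp [contractVol]

theorem contractVol_smul_left {M : ℕ} (c : ℝ) (u v : Fin (M + 2) → ℝ) :
    contractVol (c • u) v = c • contractVol u v := by
  ext w; simp [contractVol]

theorem contractVol_add_right {M : ℕ} (u v v' : Fin (M + 2) → ℝ) :
    contractVol u (v + v') = contractVol u v + contractVol u v' := by
  ext w; simp [contractVol]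

theorem contractVol_smul_right {M : ℕ} (c : ℝ) (u v : Fin (M + 2) → ℝ) :
    contractVol u (c • v) = c • contractVol u v := by
  ext w; simp [contractVol]

theorem contractVol_self {M : ℕ} (u : Fin (M + 2) → ℝ) : contractVol u u = 0 := by
  ext w; simp [contractVol]

/-- The contraction `ι_w ι_v ι_u vol` of the standard volume form of `ℝ^(K+3)`. -/
def contractVol₃ {K : ℕ} (u v w : Fin (K + 3) → ℝ) : (Fin (K + 3) → ℝ) [⋀^Fin K]→ₗ[ℝ] ℝ :=
  (contractVol (M := K + 1) u v).curryLeft w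

/-- `l ∧ ι_w ι_v ι_u vol = l(u) ι_w ι_v vol - l(v) ι_w ι_u vol + l(w) ι_v ι_u vol`. -/
theorem alternatizeUncurryFin_smulRight_contractVol₃ {K : ℕ} (l : (Fin (K + 3) → ℝ) →ₗ[ℝ] ℝ)
    (u v w : Fin (K + 3) → ℝ) (x : Fin (K + 1) → Fin (K + 3) → ℝ) :
    ∑ i : Fin (K + 1), (-1 : ℝ) ^ (i : ℕ) * (l (x i) * contractVol₃ u v w (i.removeNth x)) =
      l u * contractVol (M := K + 1) v w x - l v * contractVol (M := K + 1) u w x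
        + l w * contractVol (M := K + 1) u v x := by
  -- The form `l ∧ vol` vanishes because its degree exceeds the dimension. In its expansion at `(u,
  -- v, w, x)` the terms where `l` takes `u`, `v` or `w` give the right-hand side, and the other
  -- terms give the sum.
  have h0 : AlternatingMap.alternatizeUncurryFin
      (l.smulRight (Matrix.detRowAlternating (n := Fin (K + 3)) (R := ℝ)))
      (Matrix.vecCons u (Matrix.vecCons v (Matrix.vecCons w x))) = 0 := by
    refine AlternatingMap.map_linearDependent _ _ fun hli => ?_
    have := hli.fintype_card_le_finrank
    simp at this
  rw [AlternatingMap.alternatizeUncurryFin_apply, Fin.sum_univ_succ, Fin.sum_univ_succ,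
    Fin.sum_univ_succ] at h0
  have hcons : ∀ {m : ℕ} (i : Fin (m + 1)) (a : Fin (K + 3) → ℝ) (f : Fin (m + 1) → Fin (K + 3) → ℝ),
      Fin.removeNth i.succ (Matrix.vecCons a f) = Matrix.vecCons a (Fin.removeNth i f) := by
    intro m i a f
    ext j : 1
    cases j using Fin.cases <;> simp [Fin.removeNth]
  have hzero : ∀ {m : ℕ} (a : Fin (K + 3) → ℝ) (f : Fin m → Fin (K + 3) → ℝ),
      Fin.removeNth 0 (Matrix.vecCons a f) = f := fun a f => rfl
  simp only [hcons, hzero, Matrix.cons_val_zero, Matrix.cons_val_succ, LinearMap.smulRight_apply,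
    AlternatingMap.smul_apply, Fin.val_zero, Fin.val_succ, smul_eq_mul, pow_succ, pow_zero] at h0
  simp only [zsmul_eq_mul, Int.cast_pow, Int.cast_neg, Int.cast_one, mul_neg, mul_one,
    neg_mul, one_mul, neg_neg, Finset.sum_neg_distrib] at h0
  change _ = l u * Matrix.detRowAlternating (Matrix.vecCons v (Matrix.vecCons w x)) -
    l v * Matrix.detRowAlternating (Matrix.vecCons u (Matrix.vecCons w x)) +
    l w * Matrix.detRowAlternating (Matrix.vecCons u (Matrix.vecCons v x))
  rw [← sub_eq_zero, ← neg_eq_zero, ← h0]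
  simp only [contractVol₃, contractVol_apply, AlternatingMap.curryLeft_apply_apply]
  ring

theorem alternatingMap_sum_apply {E ι κ : Type*} [AddCommGroup E] [Module ℝ E] (s : Finset κ)
    (f : κ → E [⋀^ι]→ₗ[ℝ] ℝ) (x : ι → E) : (∑ i ∈ s, f i) x = ∑ i ∈ s, f i x := by
  classical
  induction s using Finset.induction_on with
  | empty => simp
  | insert i s hi ih => rw [Finset.sum_insert hi, Finset.sum_insert hi, AlternatingMap.add_apply, ih]

theorem det_stdVec_ne_zero_iff {N : ℕ} (f : Fin N → Fin N) :
    Matrix.detRowAlternating (R := ℝ) (fun i => stdVec (f i)) ≠ 0 ↔ Function.Injective f := by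
  constructor
  · intro h i j hij
    by_contra hne
    exact h (AlternatingMap.map_eq_zero_of_eq _ _ (by simp [hij]) hne)
  · intro h
    let σ : Equiv.Perm (Fin N) := Equiv.ofBijective f (Finite.injective_iff_bijective.1 h)
    have : (fun i => stdVec (f i)) = (fun i => (stdVec i : Fin N → ℝ)) ∘ σ := rfl
    rw [this, AlternatingMap.map_perm]
    have h1 : Matrix.detRowAlternating (R := ℝ) (fun i : Fin N => (stdVec i : Fin N → ℝ)) = 1 := by
      rw [← Matrix.det_one (n := Fin N) (R := ℝ)]
      congr 1
      ext i j
      simp [Matrix.one_apply, Pi.single_apply, eq_comm]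
    rw [h1]
    simp [Units.smul_def]

/-- `domCoprod` sums over classes of permutations modulo those preserving the two blocks. Each class
has `p! q!` elements, so this factor turns the sum into one over all permutations, which is easier
to evaluate. -/
theorem wedge_two_apply {E : Type*} [AddCommGroup E] [Module ℝ E] {p q r : ℕ} (h : p + q = r)
    (a : E [⋀^Fin p]→ₗ[ℝ] ℝ) (b : E [⋀^Fin q]→ₗ[ℝ] ℝ) (x : Fin r → E) :
    (p.factorial * q.factorial : ℝ) * wedge h a b x =
      ∑ σ : Equiv.Perm (Fin p ⊕ Fin q), (Equiv.Perm.sign σ : ℝ) *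
        (a (fun i => x (finSumFinEquiv.trans (finCongr h) (σ (Sum.inl i)))) *
          b (fun i => x (finSumFinEquiv.trans (finCongr h) (σ (Sum.inr i))))) := by
  have hl : (p.factorial * q.factorial : ℝ) * wedge h a b x = LinearMap.mul' ℝ ℝ
      (((p.factorial * q.factorial) • a.domCoprod b) (x ∘ finSumFinEquiv.trans (finCongr h))) := by
    rw [AlternatingMap.smul_apply, map_nsmul, nsmul_eq_mul, Nat.cast_mul]
    rfl
  have key := MultilinearMap.domCoprod_alternization_eq a b
  rw [Fintype.card_fin, Fintype.card_fin] at key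
  rw [hl, ← key, MultilinearMap.alternatization_apply, map_sum]
  refine Finset.sum_congr rfl fun σ _ => ?_
  rw [Units.smul_def, map_zsmul, zsmul_eq_mul]
  rfl

theorem wedge_oneForm_apply {E : Type*} [AddCommGroup E] [Module ℝ E] (a b : E →ₗ[ℝ] ℝ) (v w : E) :
    wedge (show 1 + 1 = 2 from rfl) (oneForm a) (oneForm b) ![v, w] = a v * b w - a w * b v := by
  have h := wedge_two_apply (show 1 + 1 = 2 from rfl) (oneForm a) (oneForm b) ![v, w]
  have huniv : (Finset.univ : Finset (Equiv.Perm (Fin 1 ⊕ Fin 1))) =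
      {1, Equiv.swap (Sum.inl 0) (Sum.inr 0)} := by decide
  rw [huniv, Finset.sum_pair (by decide)] at h
  simp [oneForm] at h
  refine h.trans ?_
  change a v * b w + -(a w * b v) = _
  ring

theorem contractVol_stdVec_ne_zero_iff {M : ℕ} (p q : Fin (M + 2)) (s : Fin M → Fin (M + 2)) :
    contractVol (stdVec p) (stdVec q) (fun i => stdVec (s i)) ≠ 0 ↔
      p ≠ q ∧ p ∉ Set.range s ∧ q ∉ Set.range s ∧ Function.Injective s := by
  have h : Matrix.vecCons (stdVec p) (Matrix.vecCons (stdVec q) fun i => stdVec (s i)) =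
      fun i => (stdVec (Matrix.vecCons p (Matrix.vecCons q s) i) : Fin (M + 2) → ℝ) := by
    funext i
    refine Fin.cases rfl (fun i => ?_) i
    exact Fin.cases rfl (fun i => rfl) i
  rw [contractVol_apply, h, det_stdVec_ne_zero_iff]
  change Function.Injective (Fin.cons p (Fin.cons q s : Fin (M + 1) → Fin (M + 2))) ↔ _
  rw [Fin.cons_injective_iff, Fin.cons_injective_iff, Fin.range_cons, Set.mem_insert_iff, not_or]
  tauto

/-- The contractions of the volume form by two vectors span the forms of codegree `2`. -/
theorem mem_span_contractVol {M : ℕ} (α : (Fin (M + 2) → ℝ) [⋀^Fin M]→ₗ[ℝ] ℝ) :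
    α ∈ Submodule.span ℝ (Set.range fun u : (Fin (M + 2) → ℝ) × (Fin (M + 2) → ℝ) =>
      contractVol u.1 u.2) := by
  classical
  -- The form `ν` is the component of `α` along the index set `S`. If `{p, q}` is the complement of
  -- `S`, then `ι_q ι_p vol` is nonzero on basis vectors exactly when their indices enumerate `S`,
  -- so a multiple of it will do.
  have hS : ∀ S : Finset (Fin (M + 2)), ∃ ν ∈ Submodule.span ℝ
      (Set.range fun u : (Fin (M + 2) → ℝ) × (Fin (M + 2) → ℝ) => contractVol u.1 u.2),
      S.card = M → ∀ s : Fin M → Fin (M + 2), Function.Injective s →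
        ν (fun i => stdVec (s i)) =
          if Finset.univ.image s = S then α (fun i => stdVec (s i)) else 0 := by
    intro S
    by_cases hcard : S.card = M
    swap
    · exact ⟨0, zero_mem _, fun h => absurd h hcard⟩
    have hc : Sᶜ.card = 2 := by
      rw [Finset.card_compl, hcard, Fintype.card_fin]; omega
    obtain ⟨p, q, hpq, hSc⟩ := Finset.card_eq_two.1 hc
    have hp : p ∉ S := by rw [← Finset.mem_compl, hSc]; simp
    have hq : q ∉ S := by rw [← Finset.mem_compl, hSc]; simp
    set t := S.orderEmbOfFin hcard with ht
    have ht0 : contractVol (stdVec p) (stdVec q) (fun i => stdVec (t i)) ≠ 0 := by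
      rw [contractVol_stdVec_ne_zero_iff]
      refine ⟨hpq, ?_, ?_, t.injective⟩
      · rw [ht, Finset.range_orderEmbOfFin]; exact_mod_cast hp
      · rw [ht, Finset.range_orderEmbOfFin]; exact_mod_cast hq
    refine ⟨(α (fun i => stdVec (t i)) / contractVol (stdVec p) (stdVec q) (fun i => stdVec (t i))) •
      contractVol (stdVec p) (stdVec q),
      Submodule.smul_mem _ _ (Submodule.subset_span ⟨(stdVec p, stdVec q), rfl⟩), fun _ s hs => ?_⟩
    split_ifs with him
    · have hmem : ∀ i, s i ∈ S := fun i => him ▸ Finset.mem_image_of_mem s (Finset.mem_univ i)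
      let σ₀ : Fin M ≃ S := Equiv.ofBijective (fun i => (⟨s i, hmem i⟩ : S)) (by
        rw [Fintype.bijective_iff_injective_and_card]
        exact ⟨fun i j hij => hs (Subtype.ext_iff.1 hij), by simp [hcard]⟩)
      let σ : Equiv.Perm (Fin M) := σ₀.trans (S.orderIsoOfFin hcard).symm.toEquiv
      have hst : ∀ i, s i = t (σ i) := by
        intro i
        rw [ht, ← Finset.coe_orderIsoOfFin_apply]
        simp [σ, σ₀]
      have hst' : (fun i => (stdVec (s i) : Fin (M + 2) → ℝ)) = (fun i => stdVec (t i)) ∘ σ := by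
        funext i; simp [hst]
      rw [hst', AlternatingMap.map_perm, AlternatingMap.map_perm, AlternatingMap.smul_apply]
      simp only [Units.smul_def, zsmul_eq_mul, smul_eq_mul]
      field_simp
    · rw [AlternatingMap.smul_apply]
      have : contractVol (stdVec p) (stdVec q) (fun i => stdVec (s i)) = 0 := by
        by_contra hne
        obtain ⟨-, hps, hqs, -⟩ := (contractVol_stdVec_ne_zero_iff p q s).1 hne
        refine him (Finset.eq_of_subset_of_card_le ?_ ?_)
        · intro j hj
          obtain ⟨i, -, rfl⟩ := Finset.mem_image.1 hj
          by_contra hiS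
          rw [← Finset.mem_compl, hSc, Finset.mem_insert, Finset.mem_singleton] at hiS
          rcases hiS with h | h
          · exact hps ⟨i, h⟩
          · exact hqs ⟨i, h⟩
        · rw [Finset.card_image_of_injective _ hs, hcard]; simp
      rw [this, smul_zero]
  choose ν hν hνS using hS
  have : α = ∑ S ∈ Finset.powersetCard M Finset.univ, ν S := by
    refine (Pi.basisFun ℝ (Fin (M + 2))).ext_alternating fun s hs => ?_
    simp only [Pi.basisFun_apply, alternatingMap_sum_apply]
    rw [Finset.sum_congr rfl fun S hSm => hνS S (Finset.mem_powersetCard.1 hSm).2 s hs,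
      Finset.sum_ite_eq, if_pos]
    rw [Finset.mem_powersetCard, Finset.card_image_of_injective _ hs]
    simp
  rw [this]
  exact Submodule.sum_mem _ fun S _ => hν S

/-- The functional `b ↦ ι_q ι_p vol ∧ b` on `2`-forms is a nonzero multiple of `b ↦ b(e_p, e_q)`. -/
theorem exists_wedge_contractVol_eq {M : ℕ} {p q : Fin (M + 2)} (hpq : p ≠ q) :
    ∃ c : ℝ, c ≠ 0 ∧ ∀ b : (Fin (M + 2) → ℝ) [⋀^Fin 2]→ₗ[ℝ] ℝ,
      wedge (show M + 2 = M + 2 from rfl) (contractVol (stdVec p) (stdVec q)) b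
        (fun i => stdVec i) = c * b ![stdVec p, stdVec q] := by
  classical
  let ε : Fin M ⊕ Fin 2 ≃ Fin (M + 2) := finSumFinEquiv.trans (finCongr rfl)
  let e₀ : Fin M ⊕ Fin 2 ≃ Fin (M + 2) :=
    Equiv.ofBijective (Sum.elim (fun i => i.succ.succ) ![0, 1]) (by
      rw [Fintype.bijective_iff_injective_and_card]
      refine ⟨?_, by simp⟩
      rintro (i | i) (j | j) hij
      · simpa using hij
      · fin_cases j <;> simp [Fin.ext_iff] at hij
      · fin_cases i <;> simp [Fin.ext_iff] at hij
      · fin_cases i <;> fin_cases j <;> simp at hij ⊢)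
  -- The volume form, reindexed so that its first two arguments sit in the `Sum.inr` slots, where
  -- the wedge product places the arguments of `b`.
  let g : (Fin (M + 2) → ℝ) [⋀^Fin M ⊕ Fin 2]→ₗ[ℝ] ℝ :=
    (Matrix.detRowAlternating (n := Fin (M + 2)) (R := ℝ)).domDomCongr e₀.symm
  have hg : ∀ x : Fin M ⊕ Fin 2 → Fin (M + 2) → ℝ,
      contractVol (x (Sum.inr 0)) (x (Sum.inr 1)) (fun i => x (Sum.inl i)) = g x := by
    intro x
    rw [contractVol_apply, AlternatingMap.domDomCongr_apply]
    congr 1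
    funext i
    obtain ⟨j, rfl⟩ := e₀.surjective i
    rw [Function.comp_apply, e₀.symm_apply_apply]
    rcases j with j | j
    · rfl
    · fin_cases j <;> rfl
  set d₀ : ℝ := g (fun i => stdVec (ε i)) with hd₀
  have hd₀' : d₀ ≠ 0 :=
    (det_stdVec_ne_zero_iff fun i => ε (e₀.symm i)).2 (ε.injective.comp e₀.symm.injective)
  -- Only the permutations feeding `{e_p, e_q}` to `b` contribute. They all contribute the same
  -- amount: the sign of `σ` occurs twice, and exchanging `p` and `q` changes the sign of both
  -- factors.
  let Q : Equiv.Perm (Fin M ⊕ Fin 2) → Prop := fun σ =>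
    (ε (σ (Sum.inr 0)) = p ∧ ε (σ (Sum.inr 1)) = q) ∨ (ε (σ (Sum.inr 0)) = q ∧ ε (σ (Sum.inr 1)) = p)
  have hQ : ∃ σ, Q σ := by
    let σ₁ : Equiv.Perm (Fin M ⊕ Fin 2) := Equiv.swap (Sum.inr 0) (ε.symm p)
    refine ⟨Equiv.swap (σ₁ (Sum.inr 1)) (ε.symm q) * σ₁, Or.inl ⟨?_, ?_⟩⟩
    · rw [Equiv.Perm.mul_apply, ← Equiv.eq_symm_apply]
      have h0 : σ₁ (Sum.inr 0) = ε.symm p := Equiv.swap_apply_left _ _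
      rw [h0, Equiv.swap_apply_of_ne_of_ne]
      · rw [← h0]; exact fun h => by simpa using σ₁.injective h
      · exact fun h => hpq (ε.symm.injective h)
    · rw [Equiv.Perm.mul_apply, Equiv.swap_apply_left, Equiv.apply_symm_apply]
  have hcount : (0 : ℝ) < (Finset.univ.filter Q).card := by
    obtain ⟨σ, hσ⟩ := hQ
    exact_mod_cast Finset.card_pos.2 ⟨σ, by simpa using hσ⟩
  have hfac : (0 : ℝ) < M.factorial * Nat.factorial 2 := by positivity
  refine ⟨d₀ * (Finset.univ.filter Q).card / (M.factorial * Nat.factorial 2),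
    div_ne_zero (mul_ne_zero hd₀' hcount.ne') hfac.ne', fun b => ?_⟩
  have hterm : ∀ σ : Equiv.Perm (Fin M ⊕ Fin 2), (Equiv.Perm.sign σ : ℝ) *
      (contractVol (stdVec p) (stdVec q) (fun i => stdVec (ε (σ (Sum.inl i)))) *
        b (fun i => stdVec (ε (σ (Sum.inr i))))) =
      if Q σ then d₀ * b ![stdVec p, stdVec q] else 0 := by
    intro σ
    have hb : (fun i => (stdVec (ε (σ (Sum.inr i))) : Fin (M + 2) → ℝ)) =
        ![stdVec (ε (σ (Sum.inr 0))), stdVec (ε (σ (Sum.inr 1)))] := by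
      funext i; fin_cases i <;> rfl
    have hgσ : contractVol (stdVec (ε (σ (Sum.inr 0)))) (stdVec (ε (σ (Sum.inr 1))))
        (fun i => stdVec (ε (σ (Sum.inl i)))) = (Equiv.Perm.sign σ : ℝ) * d₀ := by
      rw [hg fun i => stdVec (ε (σ i))]
      have := g.map_perm (fun i => stdVec (ε i)) σ
      rw [Units.smul_def, zsmul_eq_mul] at this
      exact this
    have hsign : (Equiv.Perm.sign σ : ℝ) * (Equiv.Perm.sign σ : ℝ) = 1 := by
      rcases Int.units_eq_one_or (Equiv.Perm.sign σ) with h | h <;> simp [h]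
    split_ifs with hσ
    · rcases hσ with ⟨h0, h1⟩ | ⟨h0, h1⟩
      · rw [h0, h1] at hgσ hb
        rw [hgσ, hb]
        linear_combination d₀ * b ![stdVec p, stdVec q] * hsign
      · rw [h0, h1] at hgσ hb
        have hswap : ∀ w : Fin M → Fin (M + 2) → ℝ, contractVol (stdVec p) (stdVec q) w =
            -contractVol (stdVec q) (stdVec p) w := by
          intro w
          have := contractVol_self (stdVec p + stdVec q : Fin (M + 2) → ℝ)
          rw [contractVol_add_left, contractVol_add_right, contractVol_add_right, contractVol_self,
            contractVol_self, zero_add, add_zero] at this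
          have := DFunLike.congr_fun this w
          rw [AlternatingMap.add_apply, AlternatingMap.zero_apply] at this
          linarith
        have hbs : b ![stdVec q, stdVec p] = -b ![stdVec p, stdVec q] := by
          have := b.map_swap ![stdVec p, stdVec q] (show (0 : Fin 2) ≠ 1 by decide)
          rw [← this]
          congr 1
          funext i; fin_cases i <;> rfl
        rw [hswap, hgσ, hb, hbs]
        linear_combination d₀ * b ![stdVec p, stdVec q] * hsign
    · have : contractVol (stdVec p) (stdVec q) (fun i => stdVec (ε (σ (Sum.inl i)))) = 0 := by
        by_contra hne
        obtain ⟨-, hp, hq, -⟩ := (contractVol_stdVec_ne_zero_iff p q _).1 hne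
        have hr : ∀ r, r ∉ (Set.range fun i => ε (σ (Sum.inl i))) →
            ε (σ (Sum.inr 0)) = r ∨ ε (σ (Sum.inr 1)) = r := by
          intro r hr
          obtain ⟨y, rfl⟩ := ε.surjective r
          obtain ⟨y, rfl⟩ := σ.surjective y
          rcases y with y | y
          · exact absurd ⟨y, rfl⟩ hr
          · fin_cases y
            · exact Or.inl rfl
            · exact Or.inr rfl
        rcases hr p hp with h1 | h1 <;> rcases hr q hq with h2 | h2
        · exact hpq (h1.symm.trans h2)
        · exact hσ (Or.inl ⟨h1, h2⟩)
        · exact hσ (Or.inr ⟨h2, h1⟩)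
        · exact hpq (h1.symm.trans h2)
      rw [this, zero_mul, mul_zero]
  have h := wedge_two_apply (show M + 2 = M + 2 from rfl) (contractVol (stdVec p) (stdVec q)) b
    (fun i => stdVec i)
  rw [Finset.sum_congr rfl fun σ _ => hterm σ, ← Finset.sum_filter, Finset.sum_const,
    nsmul_eq_mul] at h
  rw [div_mul_eq_mul_div, eq_div_iff hfac.ne']
  linear_combination h

/-- The standard symplectic form pairs each standard basis vector with exactly one other. -/
theorem exists_stdSymplectic_stdVec_ne_zero {n : ℕ} (p : Fin (2 * n)) :
    ∃ q, stdSymplectic n ![stdVec p, stdVec q] ≠ 0 ∧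
      ∀ r, r ≠ p → stdSymplectic n ![stdVec r, stdVec q] = 0 := by
  have hval : ∀ r q : Fin (2 * n), stdSymplectic n ![stdVec r, stdVec q] =
      ∑ i : Fin n, ((if 2 * (i : ℕ) = r ∧ 2 * (i : ℕ) + 1 = q then 1 else 0) -
        (if 2 * (i : ℕ) = q ∧ 2 * (i : ℕ) + 1 = r then 1 else 0) : ℝ) := by
    intro r q
    rw [stdSymplectic, alternatingMap_sum_apply]
    refine Finset.sum_congr rfl fun i _ => ?_
    rw [dx, dx, wedge_oneForm_apply]
    simp [Pi.single_apply, Fin.ext_iff, ite_and]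
    congr 1 <;> split_ifs <;> rfl
  obtain ⟨j, hj | hj⟩ := Nat.even_or_odd' p
  · have hjn : j < n := by omega
    refine ⟨⟨2 * j + 1, by omega⟩, ?_, fun r hr => ?_⟩
    · rw [hval, Finset.sum_eq_single ⟨j, hjn⟩, if_pos (by constructor <;> simp [hj]),
        if_neg (by simp)]
      · norm_num
      · intro i _ hi
        rw [Ne, Fin.ext_iff] at hi
        dsimp only at hi ⊢
        rw [if_neg (by omega), if_neg (by omega), sub_zero]
      · simp
    · rw [hval]
      refine Finset.sum_eq_zero fun i _ => ?_
      rw [Ne, Fin.ext_iff] at hr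
      dsimp only
      rw [if_neg (by omega), if_neg (by omega), sub_zero]
  · have hjn : j < n := by omega
    refine ⟨⟨2 * j, by omega⟩, ?_, fun r hr => ?_⟩
    · rw [hval, Finset.sum_eq_single ⟨j, hjn⟩, if_neg (by dsimp only; omega),
        if_pos (by constructor <;> simp [hj])]
      · norm_num
      · intro i _ hi
        rw [Ne, Fin.ext_iff] at hi
        dsimp only at hi ⊢
        rw [if_neg (by omega), if_neg (by omega), sub_zero]
      · simp
    · rw [hval]
      refine Finset.sum_eq_zero fun i _ => ?_
      rw [Ne, Fin.ext_iff] at hr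
      dsimp only
      rw [if_neg (by omega), if_neg (by omega), sub_zero]

/-- A bilinear form whose entries are nonzero multiples of those of the standard symplectic form is
non-degenerate. -/
theorem nondegenerate_of_stdVec_eq {n : ℕ} (B : LinearMap.BilinForm ℝ (Fin (2 * n) → ℝ))
    (hB : B.IsAlt) (h : ∀ p q : Fin (2 * n), p ≠ q →
      ∃ c : ℝ, c ≠ 0 ∧ B (stdVec p) (stdVec q) = c * stdSymplectic n ![stdVec p, stdVec q]) :
    B.Nondegenerate := by
  refine (LinearMap.IsRefl.nondegenerate_iff_separatingLeft hB.isRefl).2 fun u hu => ?_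
  funext p
  obtain ⟨q, hq, hr⟩ := exists_stdSymplectic_stdVec_ne_zero p
  have hpq : p ≠ q := by
    rintro rfl
    exact hq ((stdSymplectic n).map_eq_zero_of_eq _ (show _ = _ by rfl) (show (0 : Fin 2) ≠ 1 by decide))
  have hsum : u = ∑ r, u r • stdVec r := by
    funext j
    simp [Finset.sum_apply, Pi.single_apply]
  -- Pairing with the partner `q` of `p` isolates the coordinate `u p`. Since a single entry
  -- survives, nonzero rescalings of the entries do no harm.
  have h0 := hu (stdVec q)
  rw [hsum, map_sum, LinearMap.sum_apply, Finset.sum_eq_single p] at h0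
  · obtain ⟨c, hc, hcpq⟩ := h p q hpq
    rw [map_smul, LinearMap.smul_apply, hcpq, smul_eq_mul] at h0
    exact (mul_eq_zero.1 h0).resolve_right (mul_ne_zero hc hq)
  · intro r _ hrp
    rw [map_smul, LinearMap.smul_apply]
    by_cases hrq : r = q
    · rw [hrq]; simp [hB.self_eq_zero]
    · obtain ⟨c, -, hc⟩ := h r q hrq
      rw [hc, hr r hrp]; simp
  · simp

/-! ### Convolution of functionals on the torus -/

theorem isProbabilityMeasure_torus (N : ℕ) :
    IsProbabilityMeasure (volume : Measure (UnitAddTorus (Fin N))) := by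
  have : IsProbabilityMeasure (volume : Measure UnitAddCircle) := ⟨UnitAddCircle.measure_univ⟩
  exact inferInstanceAs (IsProbabilityMeasure (Measure.pi fun _ => volume))

theorem mFourier_add_apply {N : ℕ} (m : Fin N → ℤ) (x y : UnitAddTorus (Fin N)) :
    UnitAddTorus.mFourier m (x + y) = UnitAddTorus.mFourier m x * UnitAddTorus.mFourier m y := by
  simp [UnitAddTorus.mFourier, fourier_apply, smul_add, AddCircle.toCircle_add,
    Finset.prod_mul_distrib]

theorem mFourier_neg_apply {N : ℕ} (m : Fin N → ℤ) (x : UnitAddTorus (Fin N)) :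
    UnitAddTorus.mFourier m (-x) = UnitAddTorus.mFourier (-m) x := by
  simp [UnitAddTorus.mFourier, fourier_apply]

theorem mFourier_cover {N : ℕ} (m : Fin N → ℤ) (x : Fin N → ℝ) :
    UnitAddTorus.mFourier m (cover N x) =
      Complex.exp (2 * Real.pi * Complex.I * ((∑ i, (m i : ℝ) * x i : ℝ) : ℂ)) := by
  simp only [UnitAddTorus.mFourier, cover, ContinuousMap.coe_mk, fourier_coe_apply, ← Complex.exp_sum]
  congr 1
  push_cast
  rw [Finset.mul_sum]
  refine Finset.sum_congr rfl fun i _ => ?_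
  ring

theorem integral_mFourier_eq_zero {N : ℕ} {m : Fin N → ℤ} (hm : m ≠ 0) :
    ∫ x, UnitAddTorus.mFourier m x = 0 := by
  obtain ⟨i, hi⟩ := Function.ne_iff.1 hm
  have hi' : (m i : ℝ) ≠ 0 := by exact_mod_cast hi
  -- Translation by half a period of the character changes its sign but not its integral.
  set s : UnitAddTorus (Fin N) := cover N (Pi.single i (1 / (2 * (m i : ℝ)))) with hs
  have hes : UnitAddTorus.mFourier m s = -1 := by
    rw [hs, mFourier_cover, Finset.sum_eq_single i, Pi.single_eq_same, ← Complex.exp_pi_mul_I]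
    · congr 1
      have : (m i : ℝ) * (1 / (2 * (m i : ℝ))) = 1 / 2 := by field_simp
      rw [this]; push_cast; ring
    · intro j _ hj; simp [hj]
    · simp
  have h := integral_add_right_eq_self (μ := (volume : Measure (UnitAddTorus (Fin N))))
    (fun x => UnitAddTorus.mFourier m x) s
  simp only [mFourier_add_apply, hes, mul_neg, mul_one, integral_neg] at h
  exact self_eq_neg.1 h.symm

/-- The convolution `ψ ↦ S'_y (S_x (ψ (y - x)))` of two functionals on the torus. -/
def convFunctional {N : ℕ} (S S' : C(UnitAddTorus (Fin N), ℂ) →L[ℂ] ℂ) :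
    C(UnitAddTorus (Fin N), ℂ) →L[ℂ] ℂ :=
  LinearMap.mkContinuous
    { toFun := fun ψ => S' ((S : C(C(UnitAddTorus (Fin N), ℂ), ℂ)).comp
        (ψ.comp ⟨fun p : UnitAddTorus (Fin N) × UnitAddTorus (Fin N) => p.1 - p.2,
          by fun_prop⟩).curry)
      map_add' := fun ψ ψ' => by
        rw [← map_add]
        congr 1
        ext y
        exact (congrArg S (by ext; rfl)).trans (map_add S _ _)
      map_smul' := fun c ψ => by
        rw [RingHom.id_apply, ← map_smul]
        congr 1
        ext y
        exact (congrArg S (by ext; rfl)).trans (map_smul S c _) } (‖S'‖ * ‖S‖) (fun ψ => by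
    refine (S'.le_opNorm _).trans ?_
    rw [mul_assoc]
    refine mul_le_mul_of_nonneg_left ?_ (norm_nonneg _)
    refine (ContinuousMap.norm_le _ (by positivity)).2 fun y => ?_
    refine (S.le_opNorm _).trans ?_
    refine mul_le_mul_of_nonneg_left ?_ (norm_nonneg _)
    exact (ContinuousMap.norm_le _ (by positivity)).2 fun x => ψ.norm_coe_le_norm _)

theorem convFunctional_apply {N : ℕ} (S S' : C(UnitAddTorus (Fin N), ℂ) →L[ℂ] ℂ)
    (ψ : C(UnitAddTorus (Fin N), ℂ)) :
    convFunctional S S' ψ = S' ((S : C(C(UnitAddTorus (Fin N), ℂ), ℂ)).comp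
        (ψ.comp ⟨fun p : UnitAddTorus (Fin N) × UnitAddTorus (Fin N) => p.1 - p.2,
          by fun_prop⟩).curry) := rfl

theorem convFunctional_mFourier {N : ℕ} (S S' : C(UnitAddTorus (Fin N), ℂ) →L[ℂ] ℂ)
    (m : Fin N → ℤ) : convFunctional S S' (UnitAddTorus.mFourier m) =
      S (UnitAddTorus.mFourier (-m)) * S' (UnitAddTorus.mFourier m) := by
  rw [convFunctional_apply, ← smul_eq_mul, ← map_smul]
  congr 1
  ext y
  have : ((UnitAddTorus.mFourier m).comp ⟨fun p : UnitAddTorus (Fin N) × UnitAddTorus (Fin N) =>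
      p.1 - p.2, by fun_prop⟩).curry y =
      UnitAddTorus.mFourier m y • UnitAddTorus.mFourier (-m) := by
    ext x
    simp [sub_eq_add_neg, mFourier_add_apply, mFourier_neg_apply]
  rw [ContinuousMap.comp_apply, this]
  simp [mul_comm]

/-- A functional on the torus that vanishes on the nontrivial exponential monomials is a multiple of
the integral. -/
theorem eq_mul_integral_of_mFourier {N : ℕ} (F : C(UnitAddTorus (Fin N), ℂ) →L[ℂ] ℂ)
    (hF : ∀ m, m ≠ 0 → F (UnitAddTorus.mFourier m) = 0) (ψ : C(UnitAddTorus (Fin N), ℂ)) :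
    F ψ = F 1 * ∫ x, ψ x := by
  have := isProbabilityMeasure_torus N
  have hint : ∀ f : C(UnitAddTorus (Fin N), ℂ), Integrable f := fun f =>
    f.continuous.integrable_of_hasCompactSupport (HasCompactSupport.of_compactSpace _)
  let I : C(UnitAddTorus (Fin N), ℂ) →L[ℂ] ℂ := LinearMap.mkContinuous
    { toFun := fun f => ∫ x, f x
      map_add' := fun f g => integral_add (hint f) (hint g)
      map_smul' := fun c f => integral_smul c _ } 1 (fun f => by
    simpa [measureReal_def] using norm_integral_le_of_norm_le_const (μ := volume)
      (Filter.Eventually.of_forall fun x => f.norm_coe_le_norm x))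
  have hFI : F = F 1 • I := by
    refine ContinuousLinearMap.ext_on
      (Submodule.dense_iff_topologicalClosure_eq_top.2
        (UnitAddTorus.span_mFourier_closure_eq_top (d := Fin N))) ?_
    rintro _ ⟨m, rfl⟩
    by_cases hm : m = 0
    · rw [hm, UnitAddTorus.mFourier_zero]
      have : I 1 = 1 := by
        change ∫ x : UnitAddTorus (Fin N), (1 : ℂ) = 1
        simp
      simp [this]
    · have : I (UnitAddTorus.mFourier m) = 0 := integral_mFourier_eq_zero hm
      simp [this, hF m hm]
  exact DFunLike.congr_fun hFI ψ

/-- Two families of functionals that are supported in disjoint compact sets and satisfy the Fourier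
form of closedness have wedge product zero. -/
theorem wedge_eq_zero_of_disjoint {N : ℕ} {W₁ W₂ : Set (UnitAddTorus (Fin N))}
    (hW₁ : IsCompact W₁) (hW₂ : IsCompact W₂) (hdisj : Disjoint W₁ W₂)
    (S₁ S₂ : (Fin N → ℝ) → (Fin N → ℝ) → C(UnitAddTorus (Fin N), ℂ) →L[ℂ] ℂ)
    (hs₁ : ∀ u v f, (∀ x ∈ W₁, f x = 0) → S₁ u v f = 0)
    (hs₂ : ∀ u v f, (∀ x ∈ W₂, f x = 0) → S₂ u v f = 0)
    (hc₁ : ∀ (m : Fin N → ℤ) u v w, ((∑ i, (m i : ℝ) * u i : ℝ) : ℂ) * S₁ v w (UnitAddTorus.mFourier m) -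
      ((∑ i, (m i : ℝ) * v i : ℝ) : ℂ) * S₁ u w (UnitAddTorus.mFourier m) +
      ((∑ i, (m i : ℝ) * w i : ℝ) : ℂ) * S₁ u v (UnitAddTorus.mFourier m) = 0)
    (hc₂ : ∀ (m : Fin N → ℤ) u v w, ((∑ i, (m i : ℝ) * u i : ℝ) : ℂ) * S₂ v w (UnitAddTorus.mFourier m) -
      ((∑ i, (m i : ℝ) * v i : ℝ) : ℂ) * S₂ u w (UnitAddTorus.mFourier m) +
      ((∑ i, (m i : ℝ) * w i : ℝ) : ℂ) * S₂ u v (UnitAddTorus.mFourier m) = 0)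
    (u v w x : Fin N → ℝ) :
    S₁ u v 1 * S₂ w x 1 - S₁ u w 1 * S₂ v x 1 + S₁ u x 1 * S₂ v w 1
      + S₂ u v 1 * S₁ w x 1 - S₂ u w 1 * S₁ v x 1 + S₂ u x 1 * S₁ v w 1 = 0 := by
  -- The wedge product of the two families with convolution as multiplication. Its value at `1` is
  -- the expression to be shown zero.
  let F : C(UnitAddTorus (Fin N), ℂ) →L[ℂ] ℂ :=
    convFunctional (S₁ u v) (S₂ w x) - convFunctional (S₁ u w) (S₂ v x) +
      convFunctional (S₁ u x) (S₂ v w) + convFunctional (S₁ w x) (S₂ u v) -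
      convFunctional (S₁ v x) (S₂ u w) + convFunctional (S₁ v w) (S₂ u x)
  have hFm : ∀ m, F (UnitAddTorus.mFourier m) =
      S₁ u v (UnitAddTorus.mFourier (-m)) * S₂ w x (UnitAddTorus.mFourier m) -
      S₁ u w (UnitAddTorus.mFourier (-m)) * S₂ v x (UnitAddTorus.mFourier m) +
      S₁ u x (UnitAddTorus.mFourier (-m)) * S₂ v w (UnitAddTorus.mFourier m) +
      S₁ w x (UnitAddTorus.mFourier (-m)) * S₂ u v (UnitAddTorus.mFourier m) -
      S₁ v x (UnitAddTorus.mFourier (-m)) * S₂ u w (UnitAddTorus.mFourier m) +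
      S₁ v w (UnitAddTorus.mFourier (-m)) * S₂ u x (UnitAddTorus.mFourier m) := by
    intro m
    simp only [F, add_apply, sub_apply,
      convFunctional_mFourier]
  have hF0 : ∀ m, m ≠ 0 → F (UnitAddTorus.mFourier m) = 0 := by
    intro m hm
    obtain ⟨i, hi⟩ := Function.ne_iff.1 hm
    have hi' : (m i : ℝ) ≠ 0 := by exact_mod_cast hi
    -- Since `m · z = 1`, contracting `m ∧ S = 0` with `z` gives `S = m ∧ ι_z S` for both families
    -- (at frequency `-m` for `S₁`). The products in `F` then contain `m ∧ m` and cancel.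
    set z : Fin N → ℝ := Pi.single i (1 / (m i : ℝ)) with hz
    have hmz : (∑ j, (m j : ℝ) * z j : ℝ) = 1 := by
      rw [Finset.sum_eq_single i]
      · simp [hz, hi']
      · intro j _ hj; simp [hz, hj]
      · simp
    have hneg : ∀ y : Fin N → ℝ, (∑ j, (((-m) j : ℤ) : ℝ) * y j : ℝ) = -∑ j, (m j : ℝ) * y j := by
      intro y; simp [Finset.sum_neg_distrib]
    have e₂ : ∀ p q, S₂ p q (UnitAddTorus.mFourier m) =
        ((∑ i, (m i : ℝ) * p i : ℝ) : ℂ) * S₂ z q (UnitAddTorus.mFourier m) -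
        ((∑ i, (m i : ℝ) * q i : ℝ) : ℂ) * S₂ z p (UnitAddTorus.mFourier m) := by
      intro p q
      have := hc₂ m z p q
      rw [hmz, Complex.ofReal_one] at this
      linear_combination this
    have e₁ : ∀ p q, S₁ p q (UnitAddTorus.mFourier (-m)) =
        ((∑ i, (m i : ℝ) * p i : ℝ) : ℂ) * S₁ z q (UnitAddTorus.mFourier (-m)) -
        ((∑ i, (m i : ℝ) * q i : ℝ) : ℂ) * S₁ z p (UnitAddTorus.mFourier (-m)) := by
      intro p q
      have := hc₁ (-m) z p q
      simp only [hneg, hmz, Complex.ofReal_one, Complex.ofReal_neg] at this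
      linear_combination -this
    rw [hFm, e₁ u v, e₁ u w, e₁ u x, e₁ w x, e₁ v x, e₁ v w, e₂ u v, e₂ u w, e₂ u x, e₂ w x, e₂ v x,
      e₂ v w]
    ring
  have hF1 : F 1 = 0 := by
    -- The functional `F` depends only on values on `W₂ - W₁`, a closed set not containing `0`. A
    -- nonnegative bump at `0` vanishing there is killed by `F` but has positive integral, so the
    -- constant `F 1` is zero.
    set D : Set (UnitAddTorus (Fin N)) := (fun p : UnitAddTorus (Fin N) × UnitAddTorus (Fin N) =>
      p.1 - p.2) '' (W₂ ×ˢ W₁) with hD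
    have hDc : IsClosed D := ((hW₂.prod hW₁).image (by fun_prop)).isClosed
    have h0 : (0 : UnitAddTorus (Fin N)) ∉ D := by
      rintro ⟨⟨y, x⟩, ⟨hy, hx⟩, hyx⟩
      have : y = x := sub_eq_zero.1 hyx
      exact Set.disjoint_left.1 hdisj hx (this ▸ hy)
    obtain ⟨f, hf0, hf1, hf⟩ := exists_continuous_zero_one_of_isClosed hDc
      (isClosed_singleton (x := (0 : UnitAddTorus (Fin N)))) (Set.disjoint_singleton_right.2 h0)
    let ψ : C(UnitAddTorus (Fin N), ℂ) := ⟨fun x => (f x : ℂ), by fun_prop⟩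
    have hconv : ∀ p q r s, convFunctional (S₁ p q) (S₂ r s) ψ = 0 := by
      intro p q r s
      rw [convFunctional_apply]
      refine hs₂ _ _ _ fun y hy => hs₁ _ _ _ fun x hx => ?_
      change ((f (y - x) : ℝ) : ℂ) = 0
      rw [hf0 ⟨(y, x), ⟨hy, hx⟩, rfl⟩]; simp
    have hFψ : F ψ = 0 := by
      simp only [F, add_apply, sub_apply, hconv]
      simp
    rw [eq_mul_integral_of_mFourier F hF0 ψ] at hFψ
    refine (mul_eq_zero.1 hFψ).resolve_right ?_
    change ∫ x, ((f x : ℝ) : ℂ) ≠ 0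
    rw [integral_complex_ofReal]
    have hpos : 0 < ∫ x, f x := by
      refine f.continuous.integral_pos_of_hasCompactSupport_nonneg_nonzero
        (HasCompactSupport.of_compactSpace _) (fun x => (hf x).1) (x := 0) ?_
      rw [hf1 rfl]; simp
    exact_mod_cast hpos.ne'
  have := hFm 0
  rw [neg_zero, UnitAddTorus.mFourier_zero, hF1] at this
  linear_combination -this

/-! ### Calculus on the torus -/

theorem cover_add {N : ℕ} (x y : Fin N → ℝ) : cover N (x + y) = cover N x + cover N y := rfl

theorem isOpenQuotientMap_cover (N : ℕ) : IsOpenQuotientMap (cover N) :=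
  IsOpenQuotientMap.piMap fun _ => QuotientAddGroup.isOpenQuotientMap_mk

theorem continuous_cover (N : ℕ) : Continuous (cover N) := (isOpenQuotientMap_cover N).continuous

/-- The derivative of a function on the torus in the direction of a constant vector field. -/
def dirDeriv {N : ℕ} (g : UnitAddTorus (Fin N) → ℝ) (u : Fin N → ℝ) (p : UnitAddTorus (Fin N)) : ℝ :=
  deriv (fun t : ℝ => g (p + cover N (t • u))) 0

theorem dirDeriv_cover {N : ℕ} {g : UnitAddTorus (Fin N) → ℝ}
    (hg : ContDiff ℝ ∞ (fun x => g (cover N x))) (u x : Fin N → ℝ) :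
    dirDeriv g u (cover N x) = fderiv ℝ (fun x => g (cover N x)) x u := by
  have hd : HasFDerivAt (fun x => g (cover N x)) (fderiv ℝ (fun x => g (cover N x)) x) (x + (0 : ℝ) • u) := by
    rw [zero_smul, add_zero]
    exact (hg.differentiable (by simp) x).hasFDerivAt
  have hl : HasDerivAt (fun t : ℝ => x + t • u) u 0 := by
    simpa using ((hasDerivAt_id (0 : ℝ)).smul_const u).const_add x
  exact (hd.comp_hasDerivAt (0 : ℝ) hl).deriv

theorem hasDerivAt_add_cover_smul {N : ℕ} {g : UnitAddTorus (Fin N) → ℝ}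
    (hg : ContDiff ℝ ∞ (fun x => g (cover N x))) (u : Fin N → ℝ) (p : UnitAddTorus (Fin N)) (t : ℝ) :
    HasDerivAt (fun t : ℝ => g (p + cover N (t • u))) (dirDeriv g u (p + cover N (t • u))) t := by
  obtain ⟨x, rfl⟩ := (isOpenQuotientMap_cover N).surjective p
  simp only [← cover_add]
  rw [dirDeriv_cover hg]
  have hl : HasDerivAt (fun t : ℝ => x + t • u) u t := by
    simpa using ((hasDerivAt_id t).smul_const u).const_add x
  exact ((hg.differentiable (by simp) _).hasFDerivAt).comp_hasDerivAt t hl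

theorem continuous_of_comp_cover {N : ℕ} {g : UnitAddTorus (Fin N) → ℝ}
    (hg : Continuous (fun x => g (cover N x))) : Continuous g :=
  (isOpenQuotientMap_cover N).isQuotientMap.continuous_iff.2 hg

theorem contDiff_dirDeriv {N : ℕ} {g : UnitAddTorus (Fin N) → ℝ}
    (hg : ContDiff ℝ ∞ (fun x => g (cover N x))) (u : Fin N → ℝ) :
    ContDiff ℝ ∞ (fun x => dirDeriv g u (cover N x)) := by
  simp only [dirDeriv_cover hg]
  exact (hg.fderiv_right (m := ∞) (by simp)).clm_apply contDiff_const

/-- By translation invariance `t ↦ ∫ g (p + t u)` is constant. Differentiating under the integral at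
`t = 0` gives the claim. -/
theorem integral_dirDeriv_eq_zero {N : ℕ} {g : UnitAddTorus (Fin N) → ℝ}
    (hg : ContDiff ℝ ∞ (fun x => g (cover N x))) (u : Fin N → ℝ) :
    ∫ p, dirDeriv g u p = 0 := by
  have hgc : Continuous g := continuous_of_comp_cover hg.continuous
  have hdc : Continuous (dirDeriv g u) := continuous_of_comp_cover (contDiff_dirDeriv hg u).continuous
  obtain ⟨C, hC⟩ := isCompact_univ.exists_bound_of_continuousOn hdc.continuousOn
  have hcs : ∀ f : UnitAddTorus (Fin N) → ℝ, Continuous f → Integrable f := fun f hf =>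
    hf.integrable_of_hasCompactSupport (HasCompactSupport.of_compactSpace _)
  have h := (hasDerivAt_integral_of_dominated_loc_of_deriv_le (μ := volume) (x₀ := (0 : ℝ))
    (F := fun t p => g (p + cover N (t • u))) (F' := fun t p => dirDeriv g u (p + cover N (t • u)))
    (bound := fun _ => C) (s := Set.univ) Filter.univ_mem
    (Filter.Eventually.of_forall fun t => by
      exact (hgc.comp (continuous_id.add continuous_const)).aestronglyMeasurable)
    (hcs _ (hgc.comp (continuous_id.add continuous_const)))
    (hdc.comp (continuous_id.add continuous_const)).aestronglyMeasurable
    (Filter.Eventually.of_forall fun p t _ => hC _ trivial)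
    (hcs _ continuous_const)
    (Filter.Eventually.of_forall fun p t _ => hasDerivAt_add_cover_smul hg u p t)).2
  simp only [integral_add_right_eq_self (μ := (volume : Measure (UnitAddTorus (Fin N)))) g,
    integral_add_right_eq_self (μ := (volume : Measure (UnitAddTorus (Fin N)))) (dirDeriv g u)] at h
  exact h.unique (hasDerivAt_const _ _)

theorem dirDeriv_congr {N : ℕ} {f g : UnitAddTorus (Fin N) → ℝ} {p : UnitAddTorus (Fin N)}
    (h : f =ᶠ[nhds p] g) (u : Fin N → ℝ) : dirDeriv f u p = dirDeriv g u p := by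
  refine Filter.EventuallyEq.deriv_eq ?_
  have hc : Filter.Tendsto (fun t : ℝ => p + cover N (t • u)) (nhds 0) (nhds p) := by
    have : Continuous (fun t : ℝ => p + cover N (t • u)) :=
      continuous_const.add ((continuous_cover N).comp (continuous_id.smul continuous_const))
    have h2 := this.tendsto 0
    rw [zero_smul] at h2
    have h3 : cover N 0 = 0 := rfl
    rwa [h3, add_zero] at h2
  exact hc.eventually h

theorem dirDeriv_const_mul {N : ℕ} (c : ℝ) (f : UnitAddTorus (Fin N) → ℝ) (u : Fin N → ℝ)
    (p : UnitAddTorus (Fin N)) : dirDeriv (fun x => c * f x) u p = c * dirDeriv f u p :=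
  deriv_const_mul_field c

theorem contDiff_mFourier_cover {N : ℕ} (m : Fin N → ℤ) :
    ContDiff ℝ ∞ (fun x => UnitAddTorus.mFourier m (cover N x)) := by
  simp only [mFourier_cover]
  have h : ContDiff ℝ ∞ (fun x : Fin N → ℝ => ∑ i, (m i : ℝ) * x i) :=
    ContDiff.sum fun i _ => contDiff_const.mul (contDiff_apply ℝ ℝ i)
  exact ContDiff.cexp (contDiff_const.mul (Complex.ofRealCLM.contDiff.comp h))

theorem hasDerivAt_mFourier {N : ℕ} (m : Fin N → ℤ) (u : Fin N → ℝ) (p : UnitAddTorus (Fin N)) :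
    HasDerivAt (fun t : ℝ => UnitAddTorus.mFourier m (p + cover N (t • u)))
      (2 * Real.pi * Complex.I * ((∑ i, (m i : ℝ) * u i : ℝ) : ℂ) * UnitAddTorus.mFourier m p) 0 := by
  have h1 : ∀ t : ℝ, UnitAddTorus.mFourier m (p + cover N (t • u)) = UnitAddTorus.mFourier m p *
      Complex.exp ((t : ℂ) * (2 * Real.pi * Complex.I * ((∑ i, (m i : ℝ) * u i : ℝ) : ℂ))) := by
    intro t
    rw [mFourier_add_apply, mFourier_cover]
    congr 2
    have : ∑ i, (m i : ℝ) * (t • u) i = t * ∑ i, (m i : ℝ) * u i := by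
      rw [Finset.mul_sum]
      exact Finset.sum_congr rfl fun i _ => by simp; ring
    rw [this]; push_cast; ring
  simp only [h1]
  have h2 : HasDerivAt (fun t : ℝ => (t : ℂ) * (2 * Real.pi * Complex.I * ((∑ i, (m i : ℝ) * u i : ℝ) : ℂ)))
      (1 * (2 * Real.pi * Complex.I * ((∑ i, (m i : ℝ) * u i : ℝ) : ℂ))) 0 :=
    (Complex.ofRealCLM.hasDerivAt (x := (0 : ℝ))).mul_const _
  refine (h2.cexp.const_mul (UnitAddTorus.mFourier m p)).congr_deriv ?_
  rw [Complex.ofReal_zero, zero_mul, Complex.exp_zero]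
  ring

theorem dirDeriv_re_mFourier {N : ℕ} (m : Fin N → ℤ) (u : Fin N → ℝ) (p : UnitAddTorus (Fin N)) :
    dirDeriv (fun x => (UnitAddTorus.mFourier m x).re) u p =
      -(2 * Real.pi * (∑ i, (m i : ℝ) * u i)) * (UnitAddTorus.mFourier m p).im := by
  refine (Complex.reCLM.hasFDerivAt.comp_hasDerivAt (0 : ℝ) (hasDerivAt_mFourier m u p)).deriv.trans ?_
  simp

theorem dirDeriv_im_mFourier {N : ℕ} (m : Fin N → ℤ) (u : Fin N → ℝ) (p : UnitAddTorus (Fin N)) :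
    dirDeriv (fun x => (UnitAddTorus.mFourier m x).im) u p =
      2 * Real.pi * (∑ i, (m i : ℝ) * u i) * (UnitAddTorus.mFourier m p).re := by
  refine (Complex.imCLM.hasFDerivAt.comp_hasDerivAt (0 : ℝ) (hasDerivAt_mFourier m u p)).deriv.trans ?_
  simp

/-! ### Exact forms of degree `N - 2` -/

/-- The form `ι_v ι_u vol` as a continuous alternating map. -/
def contractVolL {M : ℕ} (u v : Fin (M + 2) → ℝ) : (Fin (M + 2) → ℝ) [⋀^Fin M]→L[ℝ] ℝ :=
  { contractVol u v with
    cont := by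
      change Continuous fun w : Fin M → Fin (M + 2) → ℝ =>
        Matrix.det (Matrix.vecCons u (Matrix.vecCons v w))
      refine Continuous.matrix_det ?_
      refine continuous_pi fun i => ?_
      refine Fin.cases continuous_const (fun i => ?_) i
      exact Fin.cases continuous_const (fun i => continuous_apply i) i }

theorem contractVolL_toAlternatingMap {M : ℕ} (u v : Fin (M + 2) → ℝ) :
    (contractVolL u v).toAlternatingMap = contractVol u v := rfl

/-- The form `ι_w ι_v ι_u vol` as a continuous alternating map. -/
def contractVol₃L {K : ℕ} (u v w : Fin (K + 3) → ℝ) : (Fin (K + 3) → ℝ) [⋀^Fin K]→L[ℝ] ℝ :=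
  { contractVol₃ u v w with
    cont := (contractVolL (M := K + 1) u v).cont.comp
      (continuous_pi fun i => by
        refine Fin.cases (motive := fun i => Continuous fun x : Fin K → Fin (K + 3) → ℝ =>
          (Matrix.vecCons w x : Fin (K + 1) → Fin (K + 3) → ℝ) i) continuous_const (fun i => continuous_apply i) i) }

/-- The exact form `dg ∧ ι_w ι_v ι_u vol`. -/
def exactForm {K : ℕ} (g : UnitAddTorus (Fin (K + 3)) → ℝ) (u v w : Fin (K + 3) → ℝ) :
    TorusForm (K + 3) (K + 1) := fun p =>
  dirDeriv g u p • contractVolL (M := K + 1) v w - dirDeriv g v p • contractVolL (M := K + 1) u w +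
    dirDeriv g w p • contractVolL (M := K + 1) u v

theorem exactForm_toAlternatingMap {K : ℕ} (g : UnitAddTorus (Fin (K + 3)) → ℝ)
    (u v w : Fin (K + 3) → ℝ) (p : UnitAddTorus (Fin (K + 3))) :
    (exactForm g u v w p).toAlternatingMap = dirDeriv g u p • contractVol (M := K + 1) v w -
      dirDeriv g v p • contractVol (M := K + 1) u w +
      dirDeriv g w p • contractVol (M := K + 1) u v := rfl

theorem exactForm_isSmooth {K : ℕ} {g : UnitAddTorus (Fin (K + 3)) → ℝ}
    (hg : ContDiff ℝ ∞ (fun x => g (cover (K + 3) x))) (u v w : Fin (K + 3) → ℝ) :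
    (exactForm g u v w).IsSmooth :=
  (((contDiff_dirDeriv hg u).smul contDiff_const).sub
    ((contDiff_dirDeriv hg v).smul contDiff_const)).add
    ((contDiff_dirDeriv hg w).smul contDiff_const)

/-- Exhibiting a primitive makes closedness a consequence of `d ∘ d = 0`. -/
theorem exactForm_eq_extDeriv {K : ℕ} {g : UnitAddTorus (Fin (K + 3)) → ℝ}
    (hg : ContDiff ℝ ∞ (fun x => g (cover (K + 3) x))) (u v w : Fin (K + 3) → ℝ) :
    (fun x => exactForm g u v w (cover (K + 3) x)) =
      extDeriv (fun x => g (cover (K + 3) x) • contractVol₃L u v w) := by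
  funext x
  ext y
  rw [extDeriv_apply ((hg.smul contDiff_const).differentiable (by simp) x)]
  have hf : ∀ i : Fin (K + 1), fderiv ℝ (fun x => (g (cover (K + 3) x) • contractVol₃L u v w)
      (i.removeNth y)) x (y i) =
      fderiv ℝ (fun x => g (cover (K + 3) x)) x (y i) * contractVol₃ u v w (i.removeNth y) := by
    intro i
    have h1 := ((hg.differentiable (by simp) x).hasFDerivAt.mul_const
      (contractVol₃ u v w (i.removeNth y))).fderiv
    change fderiv ℝ (fun x => g (cover (K + 3) x) * contractVol₃ u v w (i.removeNth y)) x (y i) = _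
    rw [h1]
    simp [mul_comm]
  simp only [hf]
  have h2 := alternatizeUncurryFin_smulRight_contractVol₃
    (fderiv ℝ (fun x => g (cover (K + 3) x)) x : (Fin (K + 3) → ℝ) →ₗ[ℝ] ℝ) u v w y
  simp only [ContinuousLinearMap.coe_coe, ← dirDeriv_cover hg] at h2
  simp only [← dirDeriv_cover hg, zsmul_eq_mul, Int.cast_pow, Int.cast_neg, Int.cast_one]
  rw [h2]
  rfl

theorem exactForm_isClosed {K : ℕ} {g : UnitAddTorus (Fin (K + 3)) → ℝ}
    (hg : ContDiff ℝ ∞ (fun x => g (cover (K + 3) x))) (u v w : Fin (K + 3) → ℝ) :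
    (exactForm g u v w).IsClosed := by
  intro x
  rw [exactForm_eq_extDeriv hg]
  exact extDeriv_extDeriv_apply (r := ∞) (hg.smul contDiff_const).contDiffAt
    (by rw [minSmoothness_of_isRCLikeNormedField]; exact WithTop.coe_le_coe.2 (le_top (a := (2 : ℕ∞))))

theorem wedge_linear_left {E : Type*} [AddCommGroup E] [Module ℝ E] {p q r : ℕ} (h : p + q = r)
    (a b c : ℝ) (α β γ : E [⋀^Fin p]→ₗ[ℝ] ℝ) (b' : E [⋀^Fin q]→ₗ[ℝ] ℝ) (x : Fin r → E) :
    wedge h (a • α - b • β + c • γ) b' x =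
      a * wedge h α b' x - b * wedge h β b' x + c * wedge h γ b' x := by
  have hpos : (0 : ℝ) < p.factorial * q.factorial := by positivity
  refine mul_left_cancel₀ hpos.ne' ?_
  have h1 := wedge_two_apply h α b' x
  have h2 := wedge_two_apply h β b' x
  have h3 := wedge_two_apply h γ b' x
  calc _ = _ := wedge_two_apply h _ b' x
    _ = a * ((p.factorial * q.factorial : ℝ) * wedge h α b' x) -
      b * ((p.factorial * q.factorial : ℝ) * wedge h β b' x) +
      c * ((p.factorial * q.factorial : ℝ) * wedge h γ b' x) := by
        rw [h1, h2, h3, Finset.mul_sum, Finset.mul_sum, Finset.mul_sum, ← Finset.sum_sub_distrib,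
          ← Finset.sum_add_distrib]
        refine Finset.sum_congr rfl fun σ _ => ?_
        simp only [AlternatingMap.add_apply, AlternatingMap.sub_apply, AlternatingMap.smul_apply,
          smul_eq_mul]
        ring
    _ = _ := by ring

theorem torusIntegral_exactForm {K : ℕ} {g : UnitAddTorus (Fin (K + 3)) → ℝ}
    (hg : ContDiff ℝ ∞ (fun x => g (cover (K + 3) x))) (u v w : Fin (K + 3) → ℝ)
    (b : (Fin (K + 3) → ℝ) [⋀^Fin 2]→ₗ[ℝ] ℝ) :
    torusIntegral (fun p => wedge (show K + 1 + 2 = K + 3 from rfl)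
      (exactForm g u v w p).toAlternatingMap b) = 0 := by
  have hint : ∀ u, Integrable (dirDeriv g u) := fun u =>
    (continuous_of_comp_cover (contDiff_dirDeriv hg u).continuous).integrable_of_hasCompactSupport
      (HasCompactSupport.of_compactSpace _)
  simp only [torusIntegral, exactForm_toAlternatingMap, wedge_linear_left]
  have hmul : ∀ u c, ∫ p, dirDeriv g u p * c = 0 := fun u c => by
    rw [integral_mul_const, integral_dirDeriv_eq_zero hg, zero_mul]
  have hsub : ∀ c d, Integrable (fun p => dirDeriv g u p * c - dirDeriv g v p * d) := fun c d =>
    ((hint u).mul_const _).sub ((hint v).mul_const _)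
  rw [integral_add (hsub _ _) ((hint w).mul_const _),
    integral_sub ((hint u).mul_const _) ((hint v).mul_const _), hmul, hmul, hmul]
  simp

/-! ### The functionals defined by integration over a submanifold -/

theorem IsLocalParam.mem {N m : ℕ} {W : Set (UnitAddTorus (Fin N))} {U : Set (Fin m → ℝ)}
    {φ : (Fin m → ℝ) → (Fin N → ℝ)} (h : IsLocalParam W U φ) {u : Fin m → ℝ} (hu : u ∈ U) :
    cover N (φ u) ∈ W := by
  obtain ⟨O, -, hO⟩ := h.isOpenMap U subset_rfl h.isOpen
  exact (hO ▸ Set.mem_image_of_mem (fun u => cover N (φ u)) hu : _ ∈ W ∩ O).1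

theorem IsLocalParam.continuousOn {N m : ℕ} {W : Set (UnitAddTorus (Fin N))} {U : Set (Fin m → ℝ)}
    {φ : (Fin m → ℝ) → (Fin N → ℝ)} (h : IsLocalParam W U φ) :
    ContinuousOn (fun u => cover N (φ u)) U :=
  (continuous_cover N).comp_continuousOn h.smooth.continuousOn

/-- The inverse of the parametrization is continuous on `C` because the parametrization is open onto
its image in `W`. The preimage is thus a continuous image of `C`. -/
theorem IsLocalParam.isCompact_preimage {N m : ℕ} {W : Set (UnitAddTorus (Fin N))}
    {U : Set (Fin m → ℝ)} {φ : (Fin m → ℝ) → (Fin N → ℝ)} (h : IsLocalParam W U φ)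
    {C : Set (UnitAddTorus (Fin N))} (hC : IsCompact C) (hCU : C ⊆ (fun u => cover N (φ u)) '' U) :
    IsCompact (U ∩ (fun u => cover N (φ u)) ⁻¹' C) := by
  set f : (Fin m → ℝ) → UnitAddTorus (Fin N) := fun u => cover N (φ u) with hf
  let s : UnitAddTorus (Fin N) → Fin m → ℝ := Function.invFunOn f U
  have hsf : ∀ u ∈ U, s (f u) = u := fun u hu => h.injOn.leftInvOn_invFunOn hu
  have hset : U ∩ f ⁻¹' C = s '' C := by
    ext u
    constructor
    · rintro ⟨hu, huC⟩
      exact ⟨f u, huC, hsf u hu⟩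
    · rintro ⟨c, hc, rfl⟩
      obtain ⟨u, hu, rfl⟩ := hCU hc
      rw [hsf u hu]
      exact ⟨hu, hc⟩
  rw [hset]
  refine hC.image_of_continuousOn ?_
  intro c hc
  obtain ⟨u, hu, rfl⟩ := hCU hc
  rw [ContinuousWithinAt, hsf u hu, tendsto_nhds]
  intro V hV huV
  obtain ⟨O, hO, hOe⟩ := h.isOpenMap (U ∩ V) Set.inter_subset_left (h.isOpen.inter hV)
  have hmem : f u ∈ W ∩ O := hOe ▸ Set.mem_image_of_mem f ⟨hu, huV⟩
  filter_upwards [mem_nhdsWithin_of_mem_nhds (hO.mem_nhds hmem.2), self_mem_nhdsWithin] with c hcO hcC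
  obtain ⟨u', hu', rfl⟩ := hCU hcC
  have : f u' ∈ W ∩ O := ⟨h.mem hu', hcO⟩
  rw [← hOe] at this
  obtain ⟨v, hv, hvu⟩ := this
  have hvu' : v = u' := h.injOn hv.1 hu' hvu
  change s (f u') ∈ V
  rw [hsf u' hu', ← hvu']
  exact hv.2

theorem continuousOn_pullbackCoeff {N m : ℕ} {U : Set (Fin m → ℝ)}
    {φ : (Fin m → ℝ) → (Fin N → ℝ)} (hU : IsOpen U) (hφ : ContDiffOn ℝ ∞ φ U)
    (a : (Fin N → ℝ) [⋀^Fin m]→ₗ[ℝ] ℝ) : ContinuousOn (fun u => pullbackCoeff φ u a) U := by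
  have hd : ContinuousOn (fderiv ℝ φ) U := hφ.continuousOn_fderiv_of_isOpen hU (by simp)
  have ha : Continuous a := by
    have h : ∀ w, a w = ∑ s : Fin m → Fin N, (∏ i, w i (s i)) * a (fun i => stdVec (s i)) := by
      intro w
      have hw : w = fun i => ∑ j, w i j • stdVec j := by
        funext i j
        simp [Finset.sum_apply, Pi.single_apply]
      conv_lhs => rw [hw]
      refine (a.toMultilinearMap.map_sum fun i j => w i j • stdVec j).trans ?_
      exact Finset.sum_congr rfl fun s _ =>
        a.toMultilinearMap.map_smul_univ (fun i => w i (s i)) fun i => stdVec (s i)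
    have h' : ⇑a = fun w => ∑ s : Fin m → Fin N, (∏ i, w i (s i)) * a (fun i => stdVec (s i)) :=
      funext h
    rw [h']
    fun_prop
  refine ha.comp_continuousOn (continuousOn_pi.2 fun i => ?_)
  exact hd.clm_apply continuousOn_const

section

variable {N m : ℕ} {θ : (Fin N → ℝ) [⋀^Fin m]→ₗ[ℝ] ℝ} {W : Set (UnitAddTorus (Fin N))}

/-- No control of `h` near the boundary of `P.U j` is needed: the integrand vanishes off the compact
preimage of `tsupport (P.ρ j) ∩ W`. -/
theorem OrientedPartition.integrableOn (P : OrientedPartition θ W) (hW : IsCompact W) (j : Fin P.r)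
    {h : (Fin m → ℝ) → ℝ} (hh : ContinuousOn h (P.U j)) :
    IntegrableOn (fun u => P.ρ j (cover N (P.φ j u)) * h u) (P.U j) := by
  have hP := P.isLocalParam j
  have hC : IsCompact (tsupport (P.ρ j) ∩ W) := hW.inter_left (isClosed_tsupport _)
  have hK := hP.isCompact_preimage hC (P.subordinate j)
  have hρ : Continuous (P.ρ j) := continuous_of_comp_cover (P.smooth j).continuous
  have hcont : ContinuousOn (fun u => P.ρ j (cover N (P.φ j u)) * h u) (P.U j) :=
    (hρ.comp_continuousOn hP.continuousOn).mul hh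
  refine ((hcont.mono Set.inter_subset_left).integrableOn_compact hK).of_forall_sdiff_eq_zero
    hP.isOpen.measurableSet ?_
  rintro u ⟨hu, huK⟩
  have : cover N (P.φ j u) ∉ tsupport (P.ρ j) := fun hmem => huK ⟨hu, hmem, hP.mem hu⟩
  rw [image_eq_zero_of_notMem_tsupport this, zero_mul]

theorem OrientedPartition.integrableOn_mul (P : OrientedPartition θ W) (hW : IsCompact W)
    (j : Fin P.r) {g : UnitAddTorus (Fin N) → ℝ} (hg : Continuous g)
    (a : (Fin N → ℝ) [⋀^Fin m]→ₗ[ℝ] ℝ) :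
    IntegrableOn (fun u => P.ρ j (cover N (P.φ j u)) *
      (g (cover N (P.φ j u)) * pullbackCoeff (P.φ j) u a)) (P.U j) :=
  P.integrableOn hW j ((hg.comp_continuousOn (P.isLocalParam j).continuousOn).mul
    (continuousOn_pullbackCoeff (P.isLocalParam j).isOpen (P.isLocalParam j).smooth a))

/-- The functional `g ↦ ∫_W g a` for a form `a` with constant coefficients. -/
def OrientedPartition.functional (P : OrientedPartition θ W) (hW : IsCompact W)
    (a : (Fin N → ℝ) [⋀^Fin m]→ₗ[ℝ] ℝ) : C(UnitAddTorus (Fin N), ℝ) →L[ℝ] ℝ :=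
  LinearMap.mkContinuous
    { toFun := fun g => ∑ j, ∫ u in P.U j, P.ρ j (cover N (P.φ j u)) *
        (g (cover N (P.φ j u)) * pullbackCoeff (P.φ j) u a)
      map_add' := fun f g => by
        rw [← Finset.sum_add_distrib]
        refine Finset.sum_congr rfl fun j _ => ?_
        rw [← integral_add (P.integrableOn_mul hW j f.continuous a)
          (P.integrableOn_mul hW j g.continuous a)]
        refine integral_congr_ae (Filter.Eventually.of_forall fun u => ?_)
        simp only [ContinuousMap.add_apply]
        ring
      map_smul' := fun c g => by
        rw [RingHom.id_apply, smul_eq_mul, Finset.mul_sum]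
        refine Finset.sum_congr rfl fun j _ => ?_
        rw [← integral_const_mul]
        refine integral_congr_ae (Filter.Eventually.of_forall fun u => ?_)
        simp only [ContinuousMap.smul_apply, smul_eq_mul]
        ring }
    (∑ j, ∫ u in P.U j, |P.ρ j (cover N (P.φ j u)) * (1 * pullbackCoeff (P.φ j) u a)|) (fun g => by
      rw [Finset.sum_mul]
      change ‖∑ j, ∫ u in P.U j, P.ρ j (cover N (P.φ j u)) *
        (g (cover N (P.φ j u)) * pullbackCoeff (P.φ j) u a)‖ ≤ _
      refine (norm_sum_le _ _).trans (Finset.sum_le_sum fun j _ => ?_)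
      rw [← integral_mul_const]
      refine norm_integral_le_of_norm_le
        (((P.integrableOn_mul hW j continuous_const a).abs).mul_const _)
        (Filter.Eventually.of_forall fun u => ?_)
      rw [one_mul, Real.norm_eq_abs, mul_left_comm, abs_mul, mul_comm]
      exact mul_le_mul_of_nonneg_left (g.norm_coe_le_norm _) (abs_nonneg _))

theorem OrientedPartition.functional_apply (P : OrientedPartition θ W) (hW : IsCompact W)
    (a : (Fin N → ℝ) [⋀^Fin m]→ₗ[ℝ] ℝ) (g : C(UnitAddTorus (Fin N), ℝ)) :
    P.functional hW a g = ∑ j, ∫ u in P.U j, P.ρ j (cover N (P.φ j u)) *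
        (g (cover N (P.φ j u)) * pullbackCoeff (P.φ j) u a) := rfl

theorem OrientedPartition.functional_add (P : OrientedPartition θ W) (hW : IsCompact W)
    (a b : (Fin N → ℝ) [⋀^Fin m]→ₗ[ℝ] ℝ) (g : C(UnitAddTorus (Fin N), ℝ)) :
    P.functional hW (a + b) g = P.functional hW a g + P.functional hW b g := by
  simp only [functional_apply]
  rw [← Finset.sum_add_distrib]
  refine Finset.sum_congr rfl fun j _ => ?_
  rw [← integral_add (P.integrableOn_mul hW j g.continuous a)
    (P.integrableOn_mul hW j g.continuous b)]
  refine integral_congr_ae (Filter.Eventually.of_forall fun u => ?_)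
  simp only [pullbackCoeff, AlternatingMap.add_apply]
  ring

theorem OrientedPartition.functional_smul (P : OrientedPartition θ W) (hW : IsCompact W) (c : ℝ)
    (a : (Fin N → ℝ) [⋀^Fin m]→ₗ[ℝ] ℝ) (g : C(UnitAddTorus (Fin N), ℝ)) :
    P.functional hW (c • a) g = c * P.functional hW a g := by
  simp only [functional_apply]
  rw [Finset.mul_sum]
  refine Finset.sum_congr rfl fun j _ => ?_
  rw [← integral_const_mul]
  refine integral_congr_ae (Filter.Eventually.of_forall fun u => ?_)
  simp only [pullbackCoeff, AlternatingMap.smul_apply, smul_eq_mul]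
  ring

theorem OrientedPartition.functional_congr (P : OrientedPartition θ W) (hW : IsCompact W)
    (a : (Fin N → ℝ) [⋀^Fin m]→ₗ[ℝ] ℝ) {f g : C(UnitAddTorus (Fin N), ℝ)}
    (h : ∀ p ∈ W, f p = g p) : P.functional hW a f = P.functional hW a g := by
  simp only [functional_apply]
  refine Finset.sum_congr rfl fun j _ =>
    setIntegral_congr_fun (P.isLocalParam j).isOpen.measurableSet fun u hu => ?_
  simp only [h _ ((P.isLocalParam j).mem hu)]

/-- The functional of a form `f a - g b + h c` along `W`. -/
theorem OrientedPartition.integral_eq_functional (P : OrientedPartition θ W) (hW : IsCompact W)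
    (a b c : (Fin N → ℝ) [⋀^Fin m]→ₗ[ℝ] ℝ) (f g h : C(UnitAddTorus (Fin N), ℝ)) (α : TorusForm N m)
    (hα : ∀ p ∈ W, (α p).toAlternatingMap = f p • a - g p • b + h p • c) :
    P.integral α = P.functional hW a f - P.functional hW b g + P.functional hW c h := by
  simp only [functional_apply, OrientedPartition.integral]
  rw [← Finset.sum_sub_distrib, ← Finset.sum_add_distrib]
  refine Finset.sum_congr rfl fun j _ => ?_
  have hf := P.integrableOn_mul hW j f.continuous a
  have hg := P.integrableOn_mul hW j g.continuous b
  have hh := P.integrableOn_mul hW j h.continuous c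
  rw [← integral_sub hf hg]
  refine Eq.trans ?_ (integral_add (hf.sub hg) hh)
  refine setIntegral_congr_fun (P.isLocalParam j).isOpen.measurableSet fun u hu => ?_
  simp only [hα _ ((P.isLocalParam j).mem hu), pullbackCoeff, AlternatingMap.add_apply,
    AlternatingMap.sub_apply, AlternatingMap.smul_apply, smul_eq_mul]
  ring

/-- The orienting form has positive integral against a nonnegative function that does not vanish
on `W`. -/
theorem OrientedPartition.functional_pos (P : OrientedPartition θ W) (hW : IsCompact W)
    (g : C(UnitAddTorus (Fin N), ℝ)) (hg : ∀ p, 0 ≤ g p) {p : UnitAddTorus (Fin N)} (hp : p ∈ W)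
    (hgp : 0 < g p) : 0 < P.functional hW θ g := by
  have hnn : ∀ j, ∀ u ∈ P.U j, 0 ≤ P.ρ j (cover N (P.φ j u)) *
      (g (cover N (P.φ j u)) * pullbackCoeff (P.φ j) u θ) := fun j u hu =>
    mul_nonneg (P.nonneg j _) (mul_nonneg (hg _) (P.oriented j u hu).le)
  rw [functional_apply]
  obtain ⟨j, -, hj⟩ : ∃ j ∈ Finset.univ, 0 < P.ρ j p := by
    refine Finset.exists_lt_of_sum_lt (s := Finset.univ) (f := fun _ => (0 : ℝ)) ?_
    rw [P.sum_eq_one p hp]; simp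
  refine Finset.sum_pos' (fun j _ => setIntegral_nonneg (P.isLocalParam j).isOpen.measurableSet
    (hnn j)) ⟨j, Finset.mem_univ j, ?_⟩
  obtain ⟨u, hu, hup⟩ := P.subordinate j ⟨subset_tsupport _ hj.ne', hp⟩
  have hup' : cover N (P.φ j u) = p := hup
  have hPj := P.isLocalParam j
  have hρ : Continuous (P.ρ j) := continuous_of_comp_cover (P.smooth j).continuous
  have hcont : ContinuousOn (fun u => P.ρ j (cover N (P.φ j u)) *
      (g (cover N (P.φ j u)) * pullbackCoeff (P.φ j) u θ)) (P.U j) :=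
    (hρ.comp_continuousOn hPj.continuousOn).mul ((g.continuous.comp_continuousOn
      hPj.continuousOn).mul (continuousOn_pullbackCoeff hPj.isOpen hPj.smooth θ))
  rw [setIntegral_pos_iff_support_of_nonneg_ae
    ((ae_restrict_iff' hPj.isOpen.measurableSet).2 (Filter.Eventually.of_forall (hnn j)))
    (P.integrableOn_mul hW j g.continuous θ)]
  -- The nonnegative integrand is continuous and nonzero at the parameter of `p`, so it is nonzero
  -- on a non-empty open set, which has positive measure.
  have hV := hcont.isOpen_inter_preimage hPj.isOpen (isOpen_ne (x := (0 : ℝ)))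
  have hpos := hV.measure_pos volume ⟨u, hu, ?_⟩
  · rw [Set.inter_comm]
    exact hpos
  · change P.ρ j (cover N (P.φ j u)) *
      (g (cover N (P.φ j u)) * pullbackCoeff (P.φ j) u θ) ≠ 0
    rw [hup']
    exact (mul_pos hj (mul_pos hgp (P.oriented j u hu))).ne'

end

/-! ### Cut-off functions -/

/-- A Urysohn function is approximated uniformly by a trigonometric polynomial, which is smooth, and
a smooth step then flattens the approximation near both sets. -/
theorem exists_smooth_cutoff {N : ℕ} {A B : Set (UnitAddTorus (Fin N))} (hA : IsClosed A)
    (hB : IsClosed B) (hAB : Disjoint A B) :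
    ∃ χ : C(UnitAddTorus (Fin N), ℝ), ContDiff ℝ ∞ (fun x => χ (cover N x)) ∧
      (∀ p, 0 ≤ χ p) ∧ (∀ p, χ p ≤ 1) ∧ (∀ p ∈ A, ∀ᶠ x in nhds p, χ x = 1) ∧
      (∀ p ∈ B, ∀ᶠ x in nhds p, χ x = 0) := by
  obtain ⟨f, hf0, hf1, -⟩ := exists_continuous_zero_one_of_isClosed hB hA hAB.symm
  let fc : C(UnitAddTorus (Fin N), ℂ) := ⟨fun x => (f x : ℂ), by fun_prop⟩
  have hfc : fc ∈ (Submodule.span ℂ (Set.range (UnitAddTorus.mFourier (d := Fin N)))).topologicalClosure := by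
    rw [UnitAddTorus.span_mFourier_closure_eq_top]; trivial
  obtain ⟨q, hq, hqf⟩ := Metric.mem_closure_iff.1 hfc (1 / 4) (by norm_num)
  have hqs : ContDiff ℝ ∞ (fun x => q (cover N x)) := by
    refine Submodule.span_induction (p := fun q _ => ContDiff ℝ ∞ (fun x => q (cover N x)))
      ?_ ?_ ?_ ?_ hq
    · rintro _ ⟨m, rfl⟩; exact contDiff_mFourier_cover m
    · exact contDiff_const
    · exact fun _ _ _ _ h1 h2 => h1.add h2
    · exact fun c _ _ h => contDiff_const.mul h
  have hclose : ∀ x, |(q x).re - f x| < 1 / 4 := by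
    intro x
    have h1 : ‖q x - fc x‖ < 1 / 4 := by
      rw [← dist_eq_norm, dist_comm]
      exact (ContinuousMap.dist_apply_le_dist x).trans_lt hqf
    refine lt_of_le_of_lt ?_ h1
    have := Complex.abs_re_le_norm (q x - fc x)
    simpa [fc] using this
  have hcont : Continuous fun x => (q x).re := Complex.continuous_re.comp q.continuous
  have hst : Continuous Real.smoothTransition := Real.smoothTransition.contDiff (n := 0).continuous
  -- The affine map sends `1/4` to `0` and `3/4` to `1`. With error below `1/4`, the real part of
  -- `q` exceeds `3/4` on `A` and is less than `1/4` on `B`, hence also nearby.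
  refine ⟨⟨fun x => Real.smoothTransition (2 * (q x).re - 1 / 2), by fun_prop⟩, ?_,
    fun p => Real.smoothTransition.nonneg _, fun p => Real.smoothTransition.le_one _, ?_, ?_⟩
  · exact (Real.smoothTransition.contDiff (n := ⊤)).comp
      ((contDiff_const.mul (Complex.reCLM.contDiff.comp hqs)).sub contDiff_const)
  · intro p hp
    have h1 : f p = 1 := hf1 hp
    have h2 := abs_lt.1 (hclose p)
    filter_upwards [hcont.continuousAt.eventually (lt_mem_nhds (show 3 / 4 < (q p).re by linarith))]
      with x hx
    exact Real.smoothTransition.one_of_one_le (by linarith)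
  · intro p hp
    have h1 : f p = 0 := hf0 hp
    have h2 := abs_lt.1 (hclose p)
    filter_upwards [hcont.continuousAt.eventually (gt_mem_nhds (show (q p).re < 1 / 4 by linarith))]
      with x hx
    exact Real.smoothTransition.zero_of_nonpos (by linarith)

/-! ### Localized functionals -/

/-- The complex linear extension of a functional on real functions. -/
def complexify {N : ℕ} (R : C(UnitAddTorus (Fin N), ℝ) →L[ℝ] ℝ) :
    C(UnitAddTorus (Fin N), ℂ) →L[ℂ] ℂ :=
  StrongDual.extendRCLike
    (R.comp (ContinuousLinearMap.compLeftContinuous ℝ (UnitAddTorus (Fin N)) Complex.reCLM))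

theorem complexify_apply {N : ℕ} (R : C(UnitAddTorus (Fin N), ℝ) →L[ℝ] ℝ)
    (f : C(UnitAddTorus (Fin N), ℂ)) (g h : C(UnitAddTorus (Fin N), ℝ))
    (hg : ∀ x, g x = (f x).re) (hh : ∀ x, h x = (f x).im) :
    complexify R f = R g + Complex.I * R h := by
  have h1 : ContinuousLinearMap.compLeftContinuous ℝ (UnitAddTorus (Fin N)) Complex.reCLM f = g := by
    ext x; exact (hg x).symm
  have h2 : ContinuousLinearMap.compLeftContinuous ℝ (UnitAddTorus (Fin N)) Complex.reCLM
      (Complex.I • f) = -h := by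
    ext x
    change (Complex.I * f x).re = -h x
    simp [hh x]
  rw [complexify, StrongDual.extendRCLike_apply]
  change ((R (ContinuousLinearMap.compLeftContinuous ℝ (UnitAddTorus (Fin N)) Complex.reCLM f) : ℝ) : ℂ) -
    Complex.I * ((R (ContinuousLinearMap.compLeftContinuous ℝ (UnitAddTorus (Fin N)) Complex.reCLM
      (Complex.I • f)) : ℝ) : ℂ) = _
  rw [h1, h2, map_neg]
  push_cast
  ring

/-- The functional `f ↦ ∫_W χ f ι_v ι_u vol`. -/
def localFunctional {K : ℕ} {θ : (Fin (K + 3) → ℝ) [⋀^Fin (K + 1)]→ₗ[ℝ] ℝ}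
    {W : Set (UnitAddTorus (Fin (K + 3)))} (P : OrientedPartition θ W) (hW : IsCompact W)
    (χ : C(UnitAddTorus (Fin (K + 3)), ℝ)) (u v : Fin (K + 3) → ℝ) :
    C(UnitAddTorus (Fin (K + 3)), ℝ) →L[ℝ] ℝ :=
  (P.functional hW (contractVol (M := K + 1) u v)).comp
    (ContinuousLinearMap.mul ℝ C(UnitAddTorus (Fin (K + 3)), ℝ) χ)

theorem localFunctional_apply {K : ℕ} {θ : (Fin (K + 3) → ℝ) [⋀^Fin (K + 1)]→ₗ[ℝ] ℝ}
    {W : Set (UnitAddTorus (Fin (K + 3)))} (P : OrientedPartition θ W) (hW : IsCompact W)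
    (χ : C(UnitAddTorus (Fin (K + 3)), ℝ)) (u v : Fin (K + 3) → ℝ)
    (f : C(UnitAddTorus (Fin (K + 3)), ℝ)) :
    localFunctional P hW χ u v f = P.functional hW (contractVol (M := K + 1) u v) (χ * f) := rfl

theorem complexify_localFunctional_eq_zero {K : ℕ} {θ : (Fin (K + 3) → ℝ) [⋀^Fin (K + 1)]→ₗ[ℝ] ℝ}
    {W : Set (UnitAddTorus (Fin (K + 3)))} (P : OrientedPartition θ W) (hW : IsCompact W)
    (χ : C(UnitAddTorus (Fin (K + 3)), ℝ)) (u v : Fin (K + 3) → ℝ)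
    (f : C(UnitAddTorus (Fin (K + 3)), ℂ)) (hf : ∀ x ∈ W, χ x ≠ 0 → f x = 0) :
    complexify (localFunctional P hW χ u v) f = 0 := by
  have hz : ∀ g : C(UnitAddTorus (Fin (K + 3)), ℝ), (∀ x ∈ W, χ x ≠ 0 → g x = 0) →
      localFunctional P hW χ u v g = 0 := by
    intro g hg
    rw [localFunctional_apply, P.functional_congr hW _ (g := 0), map_zero]
    intro x hx
    change χ x * g x = 0
    by_cases h : χ x = 0
    · rw [h, zero_mul]
    · rw [hg x hx h, mul_zero]
  rw [complexify_apply _ f ⟨fun x => (f x).re, by fun_prop⟩ ⟨fun x => (f x).im, by fun_prop⟩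
    (fun _ => rfl) (fun _ => rfl), hz _ fun x hx h => by simp [hf x hx h],
    hz _ fun x hx h => by simp [hf x hx h]]
  simp

/-- The form `d(χ f) ∧ ι_w ι_v ι_u vol` is exact, and along `W` it equals `χ df ∧ ι_w ι_v ι_u vol`
because `χ` is locally constant there. So each piece of `W` inherits the closedness of the whole. -/
theorem localFunctional_dirDeriv {K : ℕ} {θ : (Fin (K + 3) → ℝ) [⋀^Fin (K + 1)]→ₗ[ℝ] ℝ}
    {W : Set (UnitAddTorus (Fin (K + 3)))} (P : OrientedPartition θ W) (hW : IsCompact W)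
    (hex : ∀ g : UnitAddTorus (Fin (K + 3)) → ℝ, ContDiff ℝ ∞ (fun x => g (cover (K + 3) x)) →
      ∀ u v w, P.integral (exactForm g u v w) = 0)
    (χ : C(UnitAddTorus (Fin (K + 3)), ℝ)) (hχ : ContDiff ℝ ∞ (fun x => χ (cover (K + 3) x)))
    (hloc : ∀ p ∈ W, ∃ c, ∀ᶠ x in nhds p, χ x = c)
    (f h : C(UnitAddTorus (Fin (K + 3)), ℝ)) (hf : ContDiff ℝ ∞ (fun x => f (cover (K + 3) x)))
    (l : (Fin (K + 3) → ℝ) → ℝ) (hfh : ∀ u p, dirDeriv f u p = l u * h p) (u v w : Fin (K + 3) → ℝ) :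
    l u * localFunctional P hW χ v w h - l v * localFunctional P hW χ u w h +
      l w * localFunctional P hW χ u v h = 0 := by
  have hd : ∀ u, ∀ p ∈ W, dirDeriv (fun x => χ x * f x) u p = (χ * (l u • h)) p := by
    intro u p hp
    obtain ⟨c, hc⟩ := hloc p hp
    have hcp : χ p = c := hc.self_of_nhds
    rw [dirDeriv_congr (g := fun x => c * f x) (hc.mono fun x hx => by simp only [hx]),
      dirDeriv_const_mul, hfh, ← hcp]
    rfl
  have h1 := P.integral_eq_functional hW (contractVol (M := K + 1) v w)
    (contractVol (M := K + 1) u w) (contractVol (M := K + 1) u v) (χ * (l u • h)) (χ * (l v • h))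
    (χ * (l w • h)) (exactForm (fun x => χ x * f x) u v w) (fun p hp => by
      rw [exactForm_toAlternatingMap, hd u p hp, hd v p hp, hd w p hp])
  rw [hex _ (hχ.mul hf), ← localFunctional_apply, ← localFunctional_apply, ← localFunctional_apply,
    map_smul, map_smul, map_smul] at h1
  exact h1.symm

/-- The real and imaginary parts of a character are each other's derivatives up to the factor `± 2π
m · u`, so the real identity applies to both parts. -/
theorem complexify_localFunctional_mFourier {K : ℕ} {θ : (Fin (K + 3) → ℝ) [⋀^Fin (K + 1)]→ₗ[ℝ] ℝ}
    {W : Set (UnitAddTorus (Fin (K + 3)))} (P : OrientedPartition θ W) (hW : IsCompact W)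
    (hex : ∀ g : UnitAddTorus (Fin (K + 3)) → ℝ, ContDiff ℝ ∞ (fun x => g (cover (K + 3) x)) →
      ∀ u v w, P.integral (exactForm g u v w) = 0)
    (χ : C(UnitAddTorus (Fin (K + 3)), ℝ)) (hχ : ContDiff ℝ ∞ (fun x => χ (cover (K + 3) x)))
    (hloc : ∀ p ∈ W, ∃ c, ∀ᶠ x in nhds p, χ x = c) (m : Fin (K + 3) → ℤ) (u v w : Fin (K + 3) → ℝ) :
    ((∑ i, (m i : ℝ) * u i : ℝ) : ℂ) *
        complexify (localFunctional P hW χ v w) (UnitAddTorus.mFourier m) -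
      ((∑ i, (m i : ℝ) * v i : ℝ) : ℂ) *
        complexify (localFunctional P hW χ u w) (UnitAddTorus.mFourier m) +
      ((∑ i, (m i : ℝ) * w i : ℝ) : ℂ) *
        complexify (localFunctional P hW χ u v) (UnitAddTorus.mFourier m) = 0 := by
  let f : C(UnitAddTorus (Fin (K + 3)), ℝ) := ⟨fun x => (UnitAddTorus.mFourier m x).re, by fun_prop⟩
  let h : C(UnitAddTorus (Fin (K + 3)), ℝ) := ⟨fun x => (UnitAddTorus.mFourier m x).im, by fun_prop⟩
  have hf : ContDiff ℝ ∞ (fun x => f (cover (K + 3) x)) :=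
    Complex.reCLM.contDiff.comp (contDiff_mFourier_cover m)
  have hh : ContDiff ℝ ∞ (fun x => h (cover (K + 3) x)) :=
    Complex.imCLM.contDiff.comp (contDiff_mFourier_cover m)
  have e1 := localFunctional_dirDeriv P hW hex χ hχ hloc f h hf _ (dirDeriv_re_mFourier m) u v w
  have e2 := localFunctional_dirDeriv P hW hex χ hχ hloc h f hh _ (dirDeriv_im_mFourier m) u v w
  have hpi : (2 * Real.pi : ℝ) ≠ 0 := by positivity
  have e1' : (∑ i, (m i : ℝ) * u i) * localFunctional P hW χ v w h -
      (∑ i, (m i : ℝ) * v i) * localFunctional P hW χ u w h +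
      (∑ i, (m i : ℝ) * w i) * localFunctional P hW χ u v h = 0 := by
    refine (mul_eq_zero.1 ?_).resolve_left hpi
    linear_combination -e1
  have e2' : (∑ i, (m i : ℝ) * u i) * localFunctional P hW χ v w f -
      (∑ i, (m i : ℝ) * v i) * localFunctional P hW χ u w f +
      (∑ i, (m i : ℝ) * w i) * localFunctional P hW χ u v f = 0 := by
    refine (mul_eq_zero.1 ?_).resolve_left hpi
    linear_combination e2
  have e3 := congrArg (fun r : ℝ => (r : ℂ)) e1'
  have e4 := congrArg (fun r : ℝ => (r : ℂ)) e2'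
  simp only [Complex.ofReal_add, Complex.ofReal_sub, Complex.ofReal_mul, Complex.ofReal_zero] at e3 e4
  simp only [complexify_apply _ (UnitAddTorus.mFourier m) f h (fun _ => rfl) (fun _ => rfl)]
  linear_combination e4 + Complex.I * e3

/-! ### Connectedness -/


theorem contractVolL_isClosed {K : ℕ} (u v : Fin (K + 3) → ℝ) :
    TorusForm.IsClosed (N := K + 3) (fun _ => contractVolL (M := K + 1) u v) := by
  intro x
  ext y
  rw [extDeriv_apply (differentiableAt_const _)]
  simp

theorem torusIntegral_const {N : ℕ} (β : (Fin N → ℝ) [⋀^Fin N]→ₗ[ℝ] ℝ) :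
    torusIntegral (fun _ => β) = β (fun i => stdVec i) := by
  have := isProbabilityMeasure_torus N
  simp [torusIntegral]

/-- Non-degeneracy is required for all entrywise nonzero rescalings of `b`, because
`exists_wedge_contractVol_eq` leaves its constants undetermined. -/
theorem isConnected_of_poincareDual {K : ℕ} (hK : 2 ≤ K) {W : Set (UnitAddTorus (Fin (K + 3)))}
    (hW : IsCompact W) (θ : (Fin (K + 3) → ℝ) [⋀^Fin (K + 1)]→ₗ[ℝ] ℝ)
    (b : (Fin (K + 3) → ℝ) [⋀^Fin 2]→ₗ[ℝ] ℝ)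
    (hPD : ∀ α : TorusForm (K + 3) (K + 1), α.IsSmooth → α.IsClosed → integralOver θ W α =
      torusIntegral (fun x => wedge (show K + 1 + 2 = K + 3 from rfl) (α x).toAlternatingMap b))
    (hb : ∃ p q : Fin (K + 3), p ≠ q ∧ b ![stdVec p, stdVec q] ≠ 0)
    (hnd : ∀ B : LinearMap.BilinForm ℝ (Fin (K + 3) → ℝ), B.IsAlt → (∀ p q, p ≠ q →
      ∃ c : ℝ, c ≠ 0 ∧ B (stdVec p) (stdVec q) = c * b ![stdVec p, stdVec q]) → B.Nondegenerate) :
    IsConnected W := by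
  obtain ⟨p₀, q₀, hpq₀, hb₀⟩ := hb
  obtain ⟨c₀, hc₀, hw₀⟩ := exists_wedge_contractVol_eq (M := K + 1) hpq₀
  have hsm : ∀ u v, TorusForm.IsSmooth (N := K + 3) (fun _ => contractVolL (M := K + 1) u v) :=
    fun u v => contDiff_const
  obtain ⟨P⟩ : Nonempty (OrientedPartition θ W) := by
    -- Without an oriented partition `integralOver` takes its default value `0`, but the duality
    -- gives a nonzero value on a suitable constant form.
    by_contra hne
    have h := hPD _ (hsm (stdVec p₀) (stdVec q₀)) (contractVolL_isClosed _ _)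
    rw [integralOver, dif_neg hne, torusIntegral_const, contractVolL_toAlternatingMap, hw₀] at h
    exact mul_ne_zero hc₀ hb₀ h.symm
  obtain ⟨P, hP⟩ : ∃ P : OrientedPartition θ W, ∀ α : TorusForm (K + 3) (K + 1), α.IsSmooth →
      α.IsClosed → P.integral α = torusIntegral
        (fun x => wedge (show K + 1 + 2 = K + 3 from rfl) (α x).toAlternatingMap b) := by
    refine ⟨(⟨P⟩ : Nonempty (OrientedPartition θ W)).some, fun α h1 h2 => ?_⟩
    rw [← hPD α h1 h2, integralOver, dif_pos ⟨P⟩]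
  have hex : ∀ g : UnitAddTorus (Fin (K + 3)) → ℝ, ContDiff ℝ ∞ (fun x => g (cover (K + 3) x)) →
      ∀ u v w, P.integral (exactForm g u v w) = 0 := fun g hg u v w =>
    (hP _ (exactForm_isSmooth hg u v w) (exactForm_isClosed hg u v w)).trans
      (torusIntegral_exactForm hg u v w b)
  -- The class of `W` weighted by `g`. For `g = 1` it is the whole class, and for `χ` and `1 - χ` it
  -- is the class of a piece.
  let A : C(UnitAddTorus (Fin (K + 3)), ℝ) → LinearMap.BilinForm ℝ (Fin (K + 3) → ℝ) := fun g =>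
    LinearMap.mk₂ ℝ (fun u v => P.functional hW (contractVol (M := K + 1) u v) g)
      (fun u u' v => by rw [contractVol_add_left, P.functional_add])
      (fun c u v => by rw [contractVol_smul_left, P.functional_smul, smul_eq_mul])
      (fun u v v' => by rw [contractVol_add_right, P.functional_add])
      (fun c u v => by rw [contractVol_smul_right, P.functional_smul, smul_eq_mul])
  have hA : ∀ g u v, A g u v = P.functional hW (contractVol (M := K + 1) u v) g := fun _ _ _ => rfl
  have hA1 : ∀ p q, p ≠ q →
      ∃ c : ℝ, c ≠ 0 ∧ A 1 (stdVec p) (stdVec q) = c * b ![stdVec p, stdVec q] := by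
    intro p q hpq
    obtain ⟨c, hc, hw⟩ := exists_wedge_contractVol_eq (M := K + 1) hpq
    refine ⟨c, hc, ?_⟩
    have h := hP _ (hsm (stdVec p) (stdVec q)) (contractVolL_isClosed _ _)
    rw [torusIntegral_const, contractVolL_toAlternatingMap, hw] at h
    rw [← h, hA, P.integral_eq_functional hW (contractVol (M := K + 1) (stdVec p) (stdVec q)) 0 0 1 0 0]
    · simp
    · intro x _
      rw [contractVolL_toAlternatingMap]
      simp
  have hAalt : (A 1).IsAlt := by
    intro u
    rw [hA, contractVol_self]
    have := P.functional_smul hW 0 0 1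
    simpa using this
  have hAnd := hnd _ hAalt hA1
  refine ⟨?_, ?_⟩
  · by_contra hne
    rw [Set.not_nonempty_iff_eq_empty] at hne
    obtain ⟨c, hc, hce⟩ := hA1 p₀ q₀ hpq₀
    refine mul_ne_zero hc hb₀ ?_
    rw [← hce, hA, P.functional_congr hW _ (g := 0), map_zero]
    rw [hne]; simp
  rw [isPreconnected_iff_subset_of_fully_disjoint_closed hW.isClosed]
  intro C D hC hD hCD hdisj
  by_contra! hcon
  obtain ⟨h1, h2⟩ := hcon
  obtain ⟨p, hpW, hpC⟩ := Set.not_subset.1 h1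
  obtain ⟨q, hqW, hqD⟩ := Set.not_subset.1 h2
  have hpD : p ∈ D := (hCD hpW).resolve_left hpC
  have hqC : q ∈ C := (hCD hqW).resolve_right hqD
  obtain ⟨χ, hχ, hχ0, hχ1, hχC, hχD⟩ := exists_smooth_cutoff hC hD hdisj
  have hloc : ∀ x ∈ W, ∃ c, ∀ᶠ y in nhds x, χ y = c := by
    intro x hx
    rcases hCD hx with h | h
    · exact ⟨1, hχC x h⟩
    · exact ⟨0, hχD x h⟩
  have hloc' : ∀ x ∈ W, ∃ c, ∀ᶠ y in nhds x, (1 - χ) y = c := by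
    intro x hx
    obtain ⟨c, hc⟩ := hloc x hx
    exact ⟨1 - c, hc.mono fun y hy => by simp [hy]⟩
  have hχ' : ContDiff ℝ ∞ (fun x => (1 - χ) (cover (K + 3) x)) := contDiff_const.sub hχ
  have hone : ∀ (ξ : C(UnitAddTorus (Fin (K + 3)), ℝ)) u v,
      complexify (localFunctional P hW ξ u v) 1 = A ξ u v := by
    intro ξ u v
    rw [complexify_apply _ 1 1 0 (fun _ => by simp) (fun _ => by simp), localFunctional_apply,
      mul_one, map_zero, hA]
    simp
  have hwedge := wedge_eq_zero_of_disjoint (hW.inter_right hC) (hW.inter_right hD)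
    (hdisj.mono Set.inter_subset_right Set.inter_subset_right)
    (fun u v => complexify (localFunctional P hW χ u v))
    (fun u v => complexify (localFunctional P hW (1 - χ) u v))
    (fun u v f hf => complexify_localFunctional_eq_zero P hW χ u v f fun x hx hne =>
      hf x ⟨hx, by
        by_contra hxC
        exact hne ((hχD x ((hCD hx).resolve_left hxC)).self_of_nhds)⟩)
    (fun u v f hf => complexify_localFunctional_eq_zero P hW (1 - χ) u v f fun x hx hne =>
      hf x ⟨hx, by
        by_contra hxD
        have := (hχC x ((hCD hx).resolve_right hxD)).self_of_nhds
        exact hne (by simp [this])⟩)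
    (complexify_localFunctional_mFourier P hW hex χ hχ hloc)
    (complexify_localFunctional_mFourier P hW hex (1 - χ) hχ' hloc')
  simp only [hone] at hwedge
  have hsum : A χ + A (1 - χ) = A 1 := by
    refine LinearMap.ext₂ fun u v => ?_
    rw [LinearMap.add_apply, LinearMap.add_apply, hA, hA, hA, ← map_add, add_sub_cancel]
  -- A piece with zero class integrates every constant form to zero, including the orienting form
  -- `θ`, as all of them are combinations of the `contractVol u v`. This contradicts positivity.
  have hspan : ∀ g, A g = 0 → P.functional hW θ g = 0 := by
    intro g hg
    refine Submodule.span_induction (p := fun a _ => P.functional hW a g = 0) ?_ ?_ ?_ ?_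
      (mem_span_contractVol (M := K + 1) θ)
    · rintro _ ⟨⟨u, v⟩, rfl⟩
      rw [← hA, hg]; rfl
    · simpa using P.functional_smul hW 0 0 g
    · intro a a' _ _ h h'
      rw [P.functional_add, h, h', add_zero]
    · intro c a _ h
      rw [P.functional_smul, h, mul_zero]
  rcases eq_zero_or_eq_zero_of_wedge_eq_zero (A χ) (A (1 - χ)) (hsum ▸ hAnd) (by simp; omega)
    (fun u v w x => by exact_mod_cast hwedge u v w x) with h | h
  · have hpos := P.functional_pos hW χ hχ0 hqW (by
      rw [(hχC q hqC).self_of_nhds]; exact one_pos)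
    exact hpos.ne' (hspan _ h)
  · have hpos := P.functional_pos hW (1 - χ) (fun x => sub_nonneg.2 (hχ1 x)) hpW (by
      change 0 < 1 - χ p
      rw [(hχD p hpD).self_of_nhds]; norm_num)
    exact hpos.ne' (hspan _ h)

end SymplecticTorus

end

theorem mainTheorem6 (n : ℕ) (hn : 3 ≤ n) (k : ℕ) (hk : 0 < k)
    (W : Set (UnitAddTorus (Fin (2 * n))))
    (hW : SymplecticTorus.IsSymplecticHyperplaneSection n (by omega) k W) :
    IsConnected W := by
  obtain ⟨m, rfl⟩ : ∃ m, n = m + 2 := ⟨n - 2, by omega⟩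
  have hk' : (k : ℝ) ≠ 0 := by exact_mod_cast hk.ne'
  -- With `n = m + 2` this `K` gives `K + 3 = 2n` and `K + 1 = 2 (n - 1)`. The condition `2 ≤ K` is
  -- where `n ≥ 3` enters.
  refine SymplecticTorus.isConnected_of_poincareDual (K := 2 * m + 1) (by omega)
    hW.isClosedSubmanifold.isCompact
    (SymplecticTorus.wedgePow (SymplecticTorus.stdSymplectic (m + 2)) (m + 1))
    ((k : ℝ) • SymplecticTorus.stdSymplectic (m + 2)) hW.poincareDual ?_ ?_
  · obtain ⟨q, hq, -⟩ := SymplecticTorus.exists_stdSymplectic_stdVec_ne_zero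
      (n := m + 2) ⟨0, by omega⟩
    refine ⟨⟨0, by omega⟩, q, ?_, mul_ne_zero hk' hq⟩
    rintro rfl
    exact hq (AlternatingMap.map_eq_zero_of_eq _ _ (show _ = _ by rfl)
      (show (0 : Fin 2) ≠ 1 by decide))
  · intro B hB h
    refine SymplecticTorus.nondegenerate_of_stdVec_eq (n := m + 2) B hB fun p q hpq => ?_
    obtain ⟨c, hc, hce⟩ := h p q hpq
    exact ⟨c * k, mul_ne_zero hc hk', by rw [mul_assoc]; exact hce⟩
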